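/- Let $M$ be a smooth $n$-manifold, $\pi:L(M)\to M$ its bundle of linear frames $u:\mathbb R^n\to T_xM$, $\theta_u(Z)=u^{-1}(\pi_*Z)$ the fundamental form, $\Gamma$ a smooth linear connection on $L(M)$ with connection form $\omega$, and $\nabla$ the associated covariant derivative. $\Gamma$ is called flat affine if the curvature and torsion tensors of $\nabla$ vanish. Put $\eta(Z)=(\theta(Z),\omega(Z))\in\mathfrak{aff}(\mathbb R^n)=\mathbb R^n\rtimes\mathfrak{gl}_n(\mathbb R)$, where $[(v,A),(w,B)]=(Aw-Bv,[A,B])$. For a reduction $Q\subset L(M)$ of the frame bundle to a subgroup of $GL_n(\mathbb R)$ with Lie algebra $\mathfrak g$, we say that *$\eta$ is a homomorphism on $Q$ with values in $\mathbb R^n\rtimes\mathfrak g$* if (1) $\eta(Z)\in\mathbb R^n\rtimes\mathfrak g$ for every $Z\in TQ$, and (2) $\eta([Z_1,Z_2])=[\eta(Z_1),\eta(Z_2)]$ for all smooth local sections $Z_1,Z_2$ of $TQ$ such that $\eta(Z_1),\eta(Z_2)$ are sections of the constant sheaf on $Q$ with fibre $\mathbb R^n\rtimes\mathfrak g$, i.e.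 are locally constant. Then: (a) If $\nabla g=0$ for a pseudo-Riemannian metric $g$ of signature $(p,q)$, $p+q=n$, and $Q$ is the bundle of $g$-orthonormal frames, then $\Gamma$ is flat affine if and only if $\eta$ is a homomorphism on $Q$ with values in $\mathbb R^n\rtimes\mathfrak o(p,q)$. (b) If $\nabla\mu=0$ for a volume form $\mu$, and $Q$ is the bundle of frames $u$ with $\mu(ue_1,\dots,ue_n)=1$, then $\Gamma$ is flat affine if and only if $\eta$ is a homomorphism on $Q$ with values in $\mathbb R^n\rtimes\mathfrak{sl}_n(\mathbb R)$. (c) If $\nabla\sigma=0$ for a symplectic form $\sigma$, $n=2m$, and $Q$ is the bundle of symplectic frames, then $\Gamma$ is flat affine if and only if $\eta$ is a homomorphism on $Q$ with values in $\mathbb R^n\rtimes\mathfrak{sp}_n(\mathbb R)$ (the Lie algebra of the group of linear symplectomorphisms of $\mathbb R^n$). -/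

import Mathlib

open Set Filter Bundle
open scoped Manifold ContDiff Topology

noncomputable section

namespace FlatAffine

attribute [local instance] LieRing.ofAssociativeRing

/-! ### The Lie algebra of the affine group -/

/-- The model space `ℝⁿ`. -/
abbrev Vec (n : ℕ) : Type := EuclideanSpace ℝ (Fin n)

/-- The Lie algebra `𝔤𝔩ₙ(ℝ)` of endomorphisms of `ℝⁿ`, with the commutator bracket. -/
abbrev Gl (n : ℕ) : Type := Vec n →L[ℝ] Vec n

/-- The Lie algebra `𝔞𝔣𝔣(ℝⁿ) = ℝⁿ ⋊ 𝔤𝔩ₙ(ℝ)`. -/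
@[ext] structure Aff (n : ℕ) : Type where
  /-- the translation part -/
  trans : Vec n
  /-- the linear part -/
  lin : Gl n

namespace Aff

variable {n : ℕ}

/-- As a set, `ℝⁿ ⋊ 𝔤𝔩ₙ(ℝ)` is a product. -/
def toProd : Aff n ≃ Vec n × Gl n where
  toFun x := (x.trans, x.lin)
  invFun x := ⟨x.1, x.2⟩
  left_inv _ := rfl
  right_inv _ := rfl

instance : AddCommGroup (Aff n) := toProd.addCommGroup

instance : Module ℝ (Aff n) := toProd.module ℝ

/-- `[(v, A), (w, B)] = (A w - B v, [A, B])`. -/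
instance : Bracket (Aff n) (Aff n) where
  bracket x y := ⟨x.lin y.trans - y.lin x.trans, ⁅x.lin, y.lin⁆⟩

@[simp] lemma trans_add (x y : Aff n) : (x + y).trans = x.trans + y.trans := rfl
@[simp] lemma lin_add (x y : Aff n) : (x + y).lin = x.lin + y.lin := rfl
@[simp] lemma trans_zero : (0 : Aff n).trans = 0 := rfl
@[simp] lemma lin_zero : (0 : Aff n).lin = 0 := rfl
@[simp] lemma trans_smul (c : ℝ) (x : Aff n) : (c • x).trans = c • x.trans := rfl
@[simp] lemma lin_smul (c : ℝ) (x : Aff n) : (c • x).lin = c • x.lin := rfl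
@[simp] lemma trans_lie (x y : Aff n) : ⁅x, y⁆.trans = x.lin y.trans - y.lin x.trans := rfl
@[simp] lemma lin_lie (x y : Aff n) : ⁅x, y⁆.lin = ⁅x.lin, y.lin⁆ := rfl

instance : LieRing (Aff n) where
  add_lie x y z := by
    ext1
    · simp; abel
    · simp
  lie_add x y z := by
    ext1
    · simp; abel
    · simp
  lie_self x := by ext1 <;> simp
  leibniz_lie x y z := by
    ext1
    · simp [Ring.lie_def]; abel
    · simp

instance : LieAlgebra ℝ (Aff n) where
  lie_smul c x y := by
    ext1
    · simp [smul_sub]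
    · exact lie_smul c x.lin y.lin

end Aff

variable {n : ℕ}

/-- The Lie subalgebra `ℝⁿ ⋊ 𝔤` of `𝔞𝔣𝔣(ℝⁿ)`, for a Lie subalgebra `𝔤` of `𝔤𝔩ₙ(ℝ)`. -/
def semidirect (𝔤 : LieSubalgebra ℝ (Gl n)) : LieSubalgebra ℝ (Aff n) where
  carrier := {x | x.lin ∈ 𝔤}
  add_mem' hx hy := 𝔤.add_mem hx hy
  zero_mem' := 𝔤.zero_mem
  smul_mem' c _ hx := 𝔤.smul_mem c hx
  lie_mem' hx hy := 𝔤.lie_mem hx hy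

/-- The matrix of an endomorphism of `ℝⁿ` in the standard basis, as a map of Lie algebras. -/
def glMatrix (n : ℕ) : Gl n →ₗ⁅ℝ⁆ Matrix (Fin n) (Fin n) ℝ where
  toFun A := LinearMap.toMatrix (EuclideanSpace.basisFun (Fin n) ℝ).toBasis
    (EuclideanSpace.basisFun (Fin n) ℝ).toBasis (A : Vec n →ₗ[ℝ] Vec n)
  map_add' A B := by simp
  map_smul' c A := by simp
  map_lie' {A B} := by
    simp only [Ring.lie_def, ContinuousLinearMap.toLinearMap_sub, map_sub,
      ContinuousLinearMap.toLinearMap_mul, LinearMap.toMatrix_mul]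

/-- `𝔬(p,q)`, where `e` tells which standard coordinates of `ℝⁿ` are the `p` positive ones and
which are the `q` negative ones. -/
def oAlg {p q : ℕ} (e : Fin p ⊕ Fin q ≃ Fin n) : LieSubalgebra ℝ (Gl n) :=
  (LieAlgebra.Orthogonal.so' (Fin p) (Fin q) ℝ).comap
    (((Matrix.reindexLieEquiv (R := ℝ) e.symm).toLieHom).comp (glMatrix n))

/-- `𝔰𝔩ₙ(ℝ)`. -/
def slAlg (n : ℕ) : LieSubalgebra ℝ (Gl n) :=
  (LieAlgebra.SpecialLinear.sl (Fin n) ℝ).comap (glMatrix n)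

/-- `𝔰𝔭ₙ(ℝ)`, `n = 2m`, where `e` tells which standard coordinates of `ℝⁿ` are the `m` positions
and which are the `m` momenta. -/
def spAlg {m : ℕ} (e : Fin m ⊕ Fin m ≃ Fin n) : LieSubalgebra ℝ (Gl n) :=
  (LieAlgebra.Symplectic.sp (Fin m) ℝ).comap
    (((Matrix.reindexLieEquiv (R := ℝ) e.symm).toLieHom).comp (glMatrix n))

/-- The standard scalar product of signature `(p,q)` on `ℝⁿ`. -/
def stdMetric {p q : ℕ} (e : Fin p ⊕ Fin q ≃ Fin n) (ξ ζ : Vec n) : ℝ :=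
  ∑ i : Fin p, ξ (e (.inl i)) * ζ (e (.inl i)) - ∑ j : Fin q, ξ (e (.inr j)) * ζ (e (.inr j))

/-- The standard symplectic form on `ℝⁿ`, `n = 2m`. -/
def stdSymplectic {m : ℕ} (e : Fin m ⊕ Fin m ≃ Fin n) (ξ ζ : Vec n) : ℝ :=
  ∑ i : Fin m, (ξ (e (.inl i)) * ζ (e (.inr i)) - ξ (e (.inr i)) * ζ (e (.inl i)))

/-! ### The bundle of linear frames -/

variable (n) (M : Type*) [TopologicalSpace M] [ChartedSpace (Vec n) M] [IsManifold (𝓡 n) ∞ M]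

/-- The tangent space of `M` at `x`. -/
abbrev Tan {n : ℕ} {M : Type*} [TopologicalSpace M] [ChartedSpace (Vec n) M] (x : M) : Type :=
  TangentSpace (𝓡 n) x

/-- The total space of the vector bundle `Hom(M × ℝⁿ, TM)` over `M`.  A point is a pair of a
point `x : M` and a linear map `ℝⁿ → T_x M`.  It contains the bundle of linear frames as an open
submanifold. -/
abbrev FrameHom : Type _ :=
  TotalSpace (Vec n →L[ℝ] Vec n) (fun x : M ↦ Bundle.Trivial M (Vec n) x →L[ℝ] Tan (n := n) x)

/-- The model with corners of the manifold `FrameHom n M`. -/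
abbrev FrameModel : ModelWithCorners ℝ (Vec n × Gl n) (ModelProd (Vec n) (Gl n)) :=
  (𝓡 n).prod 𝓘(ℝ, Gl n)

variable {n M}

/-- The linear map `ℝⁿ → T_x M` underlying a point of `FrameHom n M`. -/
def fr (u : FrameHom n M) : Vec n →L[ℝ] Tan (n := n) u.proj := u.snd

variable (n M) in
/-- The bundle of linear frames `L(M)`, as an open subset of `FrameHom n M`: a frame at `x` is a
linear isomorphism `ℝⁿ → T_x M`. -/
def LM : Set (FrameHom n M) := {u | (fr u).IsInvertible}

/-- `L(M)` is open in `FrameHom n M`. -/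
lemma isOpen_LM : IsOpen (LM n M) := by
  rw [isOpen_iff_mem_nhds]
  intro u₀ hu₀
  have key : ∀ u : FrameHom n M,
      u.proj ∈ (trivializationAt (Vec n) (TangentSpace (𝓡 n) : M → Type _) u₀.proj).baseSet →
      (u ∈ LM n M ↔ ContinuousLinearMap.inCoordinates (Vec n) (Bundle.Trivial M (Vec n)) (Vec n)
        (TangentSpace (𝓡 n) : M → Type _) u₀.proj u.proj u₀.proj u.proj u.snd ∈
          range ((↑) : (Vec n ≃L[ℝ] Vec n) → Vec n →L[ℝ] Vec n)) := by
    intro u hu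
    rw [ContinuousLinearMap.inCoordinates_eq (mem_univ _) hu]
    constructor
    · rintro ⟨A, hA⟩
      have hA' : (A : Vec n →L[ℝ] Tan (n := n) u.proj) = u.snd := hA
      exact ⟨(((trivializationAt (Vec n) (Bundle.Trivial M (Vec n)) u₀.proj).continuousLinearEquivAt
        ℝ u.proj (mem_univ _)).symm.trans A).trans ((trivializationAt (Vec n)
          (TangentSpace (𝓡 n) : M → Type _) u₀.proj).continuousLinearEquivAt ℝ u.proj hu),
        by rw [← hA']; rfl⟩
    · rintro ⟨A, hA⟩
      refine ⟨(((trivializationAt (Vec n) (Bundle.Trivial M (Vec n))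
        u₀.proj).continuousLinearEquivAt ℝ u.proj (mem_univ _)).trans A).trans ((trivializationAt
          (Vec n) (TangentSpace (𝓡 n) : M → Type _) u₀.proj).continuousLinearEquivAt
            ℝ u.proj hu).symm, ?_⟩
      ext1 v
      have h := congrArg (fun B : Vec n →L[ℝ] Vec n ↦ B ((trivializationAt (Vec n)
        (Bundle.Trivial M (Vec n)) u₀.proj).continuousLinearEquivAt ℝ u.proj (mem_univ _) v)) hA
      apply ((trivializationAt (Vec n) (TangentSpace (𝓡 n) : M → Type _)
        u₀.proj).continuousLinearEquivAt ℝ u.proj hu).injective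
      refine Eq.trans ?_ (h.trans ?_)
      · exact ContinuousLinearEquiv.apply_symm_apply _ _
      · exact congrArg (fun w ↦ (trivializationAt (Vec n) (TangentSpace (𝓡 n) : M → Type _)
          u₀.proj).continuousLinearEquivAt ℝ u.proj hu (u.snd w))
          (ContinuousLinearEquiv.symm_apply_apply _ _)
  have hc := (continuousAt_hom_bundle (RingHom.id ℝ) (fun u : FrameHom n M ↦ u) (x₀ := u₀)).1
    continuousAt_id
  have hb := mem_baseSet_trivializationAt (Vec n) (TangentSpace (𝓡 n) : M → Type _) u₀.proj
  have h₁ := hc.1 ((trivializationAt (Vec n)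
    (TangentSpace (𝓡 n) : M → Type _) u₀.proj).open_baseSet.mem_nhds hb)
  have h₂ := hc.2 (ContinuousLinearEquiv.isOpen.mem_nhds ((key u₀ hb).1 hu₀))
  filter_upwards [h₁, h₂] with u hu hu'
  exact (key u hu).2 hu'

/-- The coordinates `u⁻¹ v ∈ ℝⁿ` of a tangent vector `v` in a frame `u`. -/
def coords (u : FrameHom n M) (v : Tan (n := n) u.proj) : Vec n := (fr u).inverse v

/-- The right action `R_a u = u ∘ a` of `GLₙ(ℝ)` (extended to all endomorphisms `a`). -/
def rightMul (a : Gl n) (u : FrameHom n M) : FrameHom n M := ⟨u.proj, (fr u).comp a⟩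

/-- The tangent space of the manifold of frames. -/
abbrev TanP (u : FrameHom n M) : Type := TangentSpace (FrameModel n) u

/-- The value at `u` of the fundamental vector field `A*`, i.e. the velocity at `t = 0` of the
curve `u ∘ exp (t A)`. -/
def fundamental (A : Gl n) (u : FrameHom n M) : TanP u :=
  mfderiv 𝓘(ℝ, ℝ) (FrameModel n) (fun t : ℝ ↦ rightMul (NormedSpace.exp (t • A)) u) 0 (1 : ℝ)

/-- The differential `π_*` of the projection `L(M) → M`. -/
def dproj (u : FrameHom n M) : TanP u →L[ℝ] Tan (n := n) u.proj :=
  mfderiv (FrameModel n) (𝓡 n) (TotalSpace.proj : FrameHom n M → M) u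

/-- The fundamental form `θ_u(Z) = u⁻¹ (π_* Z)` of `L(M)`. -/
def theta (u : FrameHom n M) (Z : TanP u) : Vec n := coords u (dproj u Z)

/-- A vector field on `M` that is smooth on the set `U`. -/
def SmoothFieldOn (U : Set M) (X : ∀ x : M, Tan (n := n) x) : Prop :=
  ContMDiffOn (𝓡 n) (𝓡 n).tangent ∞ (fun x ↦ (⟨x, X x⟩ : TangentBundle (𝓡 n) M)) U

/-- A vector field on the manifold of frames that is smooth on the set `U`. -/
def SmoothFieldPOn (U : Set (FrameHom n M)) (Z : ∀ u : FrameHom n M, TanP u) : Prop :=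
  ContMDiffOn (FrameModel n) (FrameModel n).tangent ∞
    (fun u ↦ (⟨u, Z u⟩ : TangentBundle (FrameModel n) (FrameHom n M))) U

/-! ### Linear connections -/

variable (n M) in
/-- A (smooth) linear connection on `L(M)`, given by its connection form: a smooth
`𝔤𝔩ₙ(ℝ)`-valued 1-form `ω` on `L(M)` with `ω(A*) = A` and `R_a^* ω = Ad(a⁻¹) ω`.  Values of `form`
at points outside `L(M)` are irrelevant. -/
structure LinearConnection where
  /-- the connection form `ω` -/
  form : ∀ u : FrameHom n M, TanP u →L[ℝ] Gl n
  smooth : ∀ (U : Set (FrameHom n M)) (Z : ∀ u : FrameHom n M, TanP u), IsOpen U → U ⊆ LM n M →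
    SmoothFieldPOn U Z → ContMDiffOn (FrameModel n) 𝓘(ℝ, Gl n) ∞ (fun u ↦ form u (Z u)) U
  form_fundamental : ∀ u ∈ LM n M, ∀ A : Gl n, form u (fundamental A u) = A
  equivariant : ∀ u ∈ LM n M, ∀ (a : Vec n ≃L[ℝ] Vec n) (Z : TanP u),
    form (rightMul (a : Gl n) u)
        (mfderiv (FrameModel n) (FrameModel n) (rightMul (M := M) (a : Gl n)) u Z) =
      (a.symm : Gl n) * form u Z * (a : Gl n)

variable (n) in
/-- The frame at `y` given by the standard local trivialization of `TM` around `x`. -/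
def frameAt (x y : M) : Vec n →L[ℝ] Tan (n := n) y :=
  (trivializationAt (Vec n) (TangentSpace (𝓡 n) : M → Type _) x).symmL ℝ y

variable (n) in
/-- The standard local section `y ↦ s(y)` of `L(M)` around `x`. -/
def localFrame (x y : M) : FrameHom n M := ⟨y, frameAt n x y⟩

/-- The components, in the local frame around `x`, of a vector field `Y`. -/
def components (x : M) (Y : ∀ y : M, Tan (n := n) y) (y : M) : Vec n :=
  (trivializationAt (Vec n) (TangentSpace (𝓡 n) : M → Type _) x).continuousLinearMapAt ℝ y (Y y)

lemma mdifferentiableAt_components {Y : ∀ y : M, Tan (n := n) y} {x : M}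
    (hY : MDifferentiableAt (𝓡 n) (𝓡 n).tangent
      (fun y ↦ (⟨y, Y y⟩ : TangentBundle (𝓡 n) M)) x) :
    MDifferentiableAt (𝓡 n) 𝓘(ℝ, Vec n) (components x Y) x := by
  have h := (mdifferentiableAt_section (IB := 𝓡 n) (F := Vec n) Y).1 hY
  refine h.congr_of_eventuallyEq ?_
  have hx := mem_baseSet_trivializationAt (Vec n) (TangentSpace (𝓡 n) : M → Type _) x
  filter_upwards [(trivializationAt (Vec n)
    (TangentSpace (𝓡 n) : M → Type _) x).open_baseSet.mem_nhds hx] with y hy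
  simp [components, Trivialization.continuousLinearMapAt_apply,
    Trivialization.coe_linearMapAt_of_mem _ hy]

lemma components_add (x : M) (Y Y' : ∀ y : M, Tan (n := n) y) :
    components x (Y + Y') = components x Y + components x Y' := by
  ext1 y; exact map_add _ _ _

lemma components_smul (x : M) (f : M → ℝ) (Y : ∀ y : M, Tan (n := n) y) :
    components x (f • Y) = f • components x Y := by
  ext1 y
  exact ContinuousLinearMap.map_smul
    ((trivializationAt (Vec n) (TangentSpace (𝓡 n) : M → Type _) x).continuousLinearMapAt ℝ y)
    (f y) (Y y)

lemma frameAt_components (x : M) (Y : ∀ y : M, Tan (n := n) y) :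
    frameAt n x x (components x Y x) = Y x := by
  have hx := mem_baseSet_trivializationAt (Vec n) (TangentSpace (𝓡 n) : M → Type _) x
  exact Trivialization.symmL_continuousLinearMapAt _ hx _

/-- The `𝔤𝔩ₙ(ℝ)`-valued 1-form `s^*ω` at `x`, for the local section `s` of `L(M)` around `x`. -/
def LinearConnection.gauge (Γ : LinearConnection n M) (x : M) : Tan (n := n) x →L[ℝ] Gl n :=
  (Γ.form (localFrame n x x)).comp (mfderiv (𝓡 n) (FrameModel n) (localFrame n x) x)

/-- The covariant derivative associated with a linear connection.  If `s` is a local section of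
`L(M)` near `x` and `Y = s f` with an `ℝⁿ`-valued function `f`, then
`∇_v Y = s(x) (df_x(v) + (s^*ω)_x(v) f(x))`; here `s` is the standard local section around `x`. -/
def LinearConnection.nabla (Γ : LinearConnection n M) :
    CovariantDerivative (𝓡 n) (Vec n) (TangentSpace (𝓡 n) : M → Type _) where
  toFun Y x := (frameAt n x x).comp
    (mvfderiv (𝓡 n) (components x Y) x +
      (ContinuousLinearMap.apply ℝ (Vec n) (components x Y x)).comp (Γ.gauge x))
  isCovariantDerivativeOnUniv := by
    refine ⟨fun {Y Y' x} hY hY' _ ↦ ?_, fun {Y f x} hY hf _ ↦ ?_⟩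
    · have h := mdifferentiableAt_components hY
      have h' := mdifferentiableAt_components hY'
      ext1 v
      rw [components_add, mvfderiv_add h h']
      change frameAt n x x ((mvfderiv (𝓡 n) (components x Y) x v +
          mvfderiv (𝓡 n) (components x Y') x v) +
          Γ.gauge x v (components x Y x + components x Y' x)) =
        frameAt n x x (mvfderiv (𝓡 n) (components x Y) x v + Γ.gauge x v (components x Y x)) +
        frameAt n x x (mvfderiv (𝓡 n) (components x Y') x v + Γ.gauge x v (components x Y' x))
      rw [← map_add, map_add (Γ.gauge x v)]
      congr 1
      abel
    · have h := mdifferentiableAt_components hY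
      ext1 v
      rw [components_smul, mvfderiv_smul hf h]
      change frameAt n x x ((f x • mvfderiv (𝓡 n) (components x Y) x v +
          mvfderiv (𝓡 n) f x v • components x Y x) +
          Γ.gauge x v (f x • components x Y x)) =
        f x • frameAt n x x (mvfderiv (𝓡 n) (components x Y) x v +
          Γ.gauge x v (components x Y x)) + mvfderiv (𝓡 n) f x v • Y x
      rw [map_smul (Γ.gauge x v), map_add, map_add, map_add, map_smul, map_smul, map_smul,
        frameAt_components, smul_add]
      abel

/-- The curvature `R(X,Y)Z = ∇_X ∇_Y Z - ∇_Y ∇_X Z - ∇_{[X,Y]} Z` at `x`. -/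
def LinearConnection.curvature (Γ : LinearConnection n M) (X Y Z : ∀ x : M, Tan (n := n) x)
    (x : M) : Tan (n := n) x :=
  Γ.nabla (fun y ↦ Γ.nabla Z y (Y y)) x (X x) - Γ.nabla (fun y ↦ Γ.nabla Z y (X y)) x (Y x) -
    Γ.nabla Z x (VectorField.mlieBracket (𝓡 n) X Y x)

/-- A connection is flat affine if its curvature and torsion tensors both vanish. -/
def LinearConnection.IsFlatAffine (Γ : LinearConnection n M) : Prop :=
  (∀ (U : Set M) (X Y Z : ∀ x : M, Tan (n := n) x), IsOpen U → SmoothFieldOn U X →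
    SmoothFieldOn U Y → SmoothFieldOn U Z → ∀ x ∈ U, Γ.curvature X Y Z x = 0) ∧
  Γ.nabla.torsion = 0

/-! ### The map `η` and reductions of the frame bundle -/

/-- `η(Z) = (θ(Z), ω(Z)) ∈ 𝔞𝔣𝔣(ℝⁿ)`. -/
def LinearConnection.eta (Γ : LinearConnection n M) (u : FrameHom n M) (Z : TanP u) : Aff n :=
  ⟨theta u Z, Γ.form u Z⟩

/-- `Z ∈ T_u P` is tangent to the submanifold `Q` of `P`: it is the velocity at `t = 0` of a
smooth curve in `Q` that passes through `u` at `t = 0`. -/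
def IsTangentTo (Q : Set (FrameHom n M)) (u : FrameHom n M) (Z : TanP u) : Prop :=
  ∃ c : ℝ → FrameHom n M, ContMDiffAt 𝓘(ℝ, ℝ) (FrameModel n) ∞ c 0 ∧ (∀ᶠ t in 𝓝 0, c t ∈ Q) ∧
    tangentMap 𝓘(ℝ, ℝ) (FrameModel n) c ⟨0, (1 : ℝ)⟩ = ⟨u, Z⟩

/-- `Z` represents a section over `Q ∩ U` of the tangent bundle of the submanifold `Q` of `L(M)`:
it is the restriction to `Q ∩ U` of a vector field which is smooth on the open set `U` and tangent
to `Q` along `Q ∩ U`.  The Lie bracket of two sections is the restriction of the bracket of the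
extensions. -/
structure IsSectionOn (Q U : Set (FrameHom n M)) (Z : ∀ u : FrameHom n M, TanP u) : Prop where
  smooth : SmoothFieldPOn U Z
  tangent : ∀ u ∈ Q ∩ U, IsTangentTo Q u (Z u)

/-- `f` restricts to a locally constant function on `S`, that is, to a section over `S` of the
constant sheaf. -/
def LocConstOn {α β : Type*} [TopologicalSpace α] (f : α → β) (S : Set α) : Prop :=
  ∀ u ∈ S, ∀ᶠ v in 𝓝[S] u, f v = f u

/-- For a submanifold `Q` of `L(M)` and a Lie subalgebra `𝔤` of `𝔤𝔩ₙ(ℝ)`: the map `η = (θ, ω)`,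
restricted to `Q`, takes values in `ℝⁿ ⋊ 𝔤` and is a homomorphism of sheaves of real Lie algebras
to the constant sheaf on `Q` with fibre `ℝⁿ ⋊ 𝔤`: `η([Z₁, Z₂]) = [η(Z₁), η(Z₂)]` for all local
sections `Z₁`, `Z₂` of `TQ` which `η` maps to sections (locally constant functions) of this sheaf.
(`η` is `ℝ`-linear and compatible with restrictions by construction.) -/
structure LinearConnection.EtaIsHom (Γ : LinearConnection n M) (Q : Set (FrameHom n M))
    (𝔤 : LieSubalgebra ℝ (Gl n)) : Prop where
  values : ∀ u ∈ Q, ∀ Z : TanP u, IsTangentTo Q u Z → Γ.eta u Z ∈ semidirect 𝔤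
  map_lie : ∀ (U : Set (FrameHom n M)) (Z₁ Z₂ : ∀ u : FrameHom n M, TanP u),
    IsOpen U → U ⊆ LM n M → IsSectionOn Q U Z₁ → IsSectionOn Q U Z₂ →
    LocConstOn (fun u ↦ Γ.eta u (Z₁ u)) (Q ∩ U) → LocConstOn (fun u ↦ Γ.eta u (Z₂ u)) (Q ∩ U) →
    ∀ u ∈ Q ∩ U, Γ.eta u (VectorField.mlieBracket (FrameModel n) Z₁ Z₂ u) =
      ⁅Γ.eta u (Z₁ u), Γ.eta u (Z₂ u)⁆

/-! ### Metric, volume-preserving and symplectic connections -/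

variable (n M) in
/-- A (smooth) pseudo-Riemannian metric on `M`. -/
structure PseudoMetric where
  /-- the scalar product on `T_x M` -/
  val : ∀ x : M, LinearMap.BilinForm ℝ (Tan (n := n) x)
  symm : ∀ x v w, val x v w = val x w v
  nondegenerate : ∀ x v, (∀ w, val x v w = 0) → v = 0
  smooth : ∀ (U : Set M) (X Y : ∀ x : M, Tan (n := n) x), IsOpen U → SmoothFieldOn U X →
    SmoothFieldOn U Y → ContMDiffOn (𝓡 n) 𝓘(ℝ, ℝ) ∞ (fun x ↦ val x (X x) (Y x)) U

/-- `g` has signature `(p,q)`: every tangent space has a basis in which `g` is diagonal with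
`p` entries `1` and `q` entries `-1`. -/
def PseudoMetric.HasSignature (g : PseudoMetric n M) (p q : ℕ) : Prop :=
  ∀ x : M, ∃ b : Module.Basis (Fin p ⊕ Fin q) ℝ (Tan (n := n) x),
    ∀ i j, g.val x (b i) (b j) = LieAlgebra.Orthogonal.indefiniteDiagonal (Fin p) (Fin q) ℝ i j

/-- `∇g = 0`, i.e. `v(g(Y,Z)) = g(∇_v Y, Z) + g(Y, ∇_v Z)`. -/
def LinearConnection.PreservesMetric (Γ : LinearConnection n M) (g : PseudoMetric n M) : Prop :=
  ∀ (U : Set M) (Y Z : ∀ x : M, Tan (n := n) x), IsOpen U → SmoothFieldOn U Y →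
    SmoothFieldOn U Z → ∀ x ∈ U, ∀ v : Tan (n := n) x,
      mvfderiv (𝓡 n) (fun y ↦ g.val y (Y y) (Z y)) x v =
        g.val x (Γ.nabla Y x v) (Z x) + g.val x (Y x) (Γ.nabla Z x v)

/-- The reduction of `L(M)` to `O(p,q)`: the frames that are isometries from `ℝⁿ` with its
standard scalar product of signature `(p,q)`. -/
def PseudoMetric.frames (g : PseudoMetric n M) {p q : ℕ} (e : Fin p ⊕ Fin q ≃ Fin n) :
    Set (FrameHom n M) :=
  {u | u ∈ LM n M ∧ ∀ ξ ζ : Vec n, g.val u.proj (fr u ξ) (fr u ζ) = stdMetric e ξ ζ}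

variable (n M) in
/-- A (smooth) volume form on `M`: a nowhere vanishing `n`-form. -/
structure VolumeForm where
  /-- the alternating form on `T_x M` -/
  val : ∀ x : M, Tan (n := n) x [⋀^Fin n]→ₗ[ℝ] ℝ
  ne_zero : ∀ x, val x ≠ 0
  smooth : ∀ (U : Set M) (X : Fin n → ∀ x : M, Tan (n := n) x), IsOpen U →
    (∀ i, SmoothFieldOn U (X i)) → ContMDiffOn (𝓡 n) 𝓘(ℝ, ℝ) ∞ (fun x ↦ val x (fun i ↦ X i x)) U

/-- `∇μ = 0`, i.e. `v(μ(Y₁,…,Yₙ)) = ∑ᵢ μ(Y₁,…,∇_v Yᵢ,…,Yₙ)`. -/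
def LinearConnection.PreservesVolume (Γ : LinearConnection n M) (μ : VolumeForm n M) : Prop :=
  ∀ (U : Set M) (Y : Fin n → ∀ x : M, Tan (n := n) x), IsOpen U → (∀ i, SmoothFieldOn U (Y i)) →
    ∀ x ∈ U, ∀ v : Tan (n := n) x,
      mvfderiv (𝓡 n) (fun y ↦ μ.val y (fun i ↦ Y i y)) x v =
        ∑ i, μ.val x (Function.update (fun j ↦ Y j x) i (Γ.nabla (Y i) x v))

/-- The reduction of `L(M)` to `SLₙ(ℝ)`: the frames of volume `1`. -/
def VolumeForm.frames (μ : VolumeForm n M) : Set (FrameHom n M) :=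
  {u | u ∈ LM n M ∧ μ.val u.proj (fun i ↦ fr u (EuclideanSpace.single i 1)) = 1}

variable (n M) in
/-- A symplectic form on `M`: a smooth closed non-degenerate 2-form. -/
structure SymplecticForm where
  /-- the alternating bilinear form on `T_x M` -/
  val : ∀ x : M, LinearMap.BilinForm ℝ (Tan (n := n) x)
  alt : ∀ x v, val x v v = 0
  nondegenerate : ∀ x v, (∀ w, val x v w = 0) → v = 0
  smooth : ∀ (U : Set M) (X Y : ∀ x : M, Tan (n := n) x), IsOpen U → SmoothFieldOn U X →
    SmoothFieldOn U Y → ContMDiffOn (𝓡 n) 𝓘(ℝ, ℝ) ∞ (fun x ↦ val x (X x) (Y x)) U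
  closed : ∀ (U : Set M) (X Y Z : ∀ x : M, Tan (n := n) x), IsOpen U → SmoothFieldOn U X →
    SmoothFieldOn U Y → SmoothFieldOn U Z → ∀ x ∈ U,
      mvfderiv (𝓡 n) (fun y ↦ val y (Y y) (Z y)) x (X x) +
      mvfderiv (𝓡 n) (fun y ↦ val y (Z y) (X y)) x (Y x) +
      mvfderiv (𝓡 n) (fun y ↦ val y (X y) (Y y)) x (Z x) -
      val x (VectorField.mlieBracket (𝓡 n) X Y x) (Z x) -
      val x (VectorField.mlieBracket (𝓡 n) Y Z x) (X x) -
      val x (VectorField.mlieBracket (𝓡 n) Z X x) (Y x) = 0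

/-- `∇σ = 0`, i.e. `v(σ(Y,Z)) = σ(∇_v Y, Z) + σ(Y, ∇_v Z)`. -/
def LinearConnection.PreservesSymplectic (Γ : LinearConnection n M) (σ : SymplecticForm n M) :
    Prop :=
  ∀ (U : Set M) (Y Z : ∀ x : M, Tan (n := n) x), IsOpen U → SmoothFieldOn U Y →
    SmoothFieldOn U Z → ∀ x ∈ U, ∀ v : Tan (n := n) x,
      mvfderiv (𝓡 n) (fun y ↦ σ.val y (Y y) (Z y)) x v =
        σ.val x (Γ.nabla Y x v) (Z x) + σ.val x (Y x) (Γ.nabla Z x v)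

/-- The reduction of `L(M)` to `Spₙ(ℝ)`: the frames that are symplectic isomorphisms from `ℝⁿ`
with its standard symplectic form. -/
def SymplecticForm.frames (σ : SymplecticForm n M) {m : ℕ} (e : Fin m ⊕ Fin m ≃ Fin n) :
    Set (FrameHom n M) :=
  {u | u ∈ LM n M ∧ ∀ ξ ζ : Vec n, σ.val u.proj (fr u ξ) (fr u ζ) = stdSymplectic e ξ ζ}

end FlatAffine

end

open Set Filter Bundle
open scoped Manifold ContDiff Topology

set_option linter.unusedSectionVars false

noncomputable section

/-! At every frame, η = (θ, ω) is a linear isomorphism from the tangent space of L(M) onto ℝⁿ ⋊ 𝔤𝔩ₙ.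
Over a chart, with its coordinate frame, a frame is a pair (z, a), the connection is a function A
with A_z(v) ∈ 𝔤𝔩ₙ, and η(v, b) = (a⁻¹v, a⁻¹(A_z(v)a + b)). The vector with η = (ξ, B) is therefore
(aξ, aB − A_z(aξ)a); this is `etaField`.

Differentiating such fields gives Cartan's structure equations (`lieBracket_etaField`,
`LinearConnection.eta_mlieBracket`): if η(Zᵢ) = (ξᵢ, Bᵢ) is constant, then η([Z₁, Z₂]) = [η(Z₁),
η(Z₂)] − (a⁻¹T(aξ₁, aξ₂), a⁻¹R(aξ₁, aξ₂)a), where T and R are the torsion and curvature in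
coordinates. Torsion and curvature are thus exactly the failure of η to be a homomorphism.

On a reduction Q the values η(Zᵢ) are known only along Q. This suffices: the bracket needs only the
derivative of each Zᵢ in the direction of the other, and both directions are velocities of curves in
Q. The equivalence therefore holds on Q (`LinearConnection.isFlatAffine_iff_etaIsHom`) once ω maps
TQ into 𝔤, the horizontal vectors (those with η = (ξ, 0)) are tangent to Q, and Q meets every fibre.
The horizontal fields then recover all values of T and R.

The first two conditions come from the parallel tensor
(`LinearConnection.isFlatAffine_iff_etaIsHom_of_hasDerivAt`). Let F be the components of the tensor
in a frame, so that Q = {F = w}. As ∇ kills the tensor, the derivative of F along a curve of frames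
depends only on C = ω(velocity), being the infinitesimal action of C. Along Q it vanishes, which
puts C in 𝔤; along a horizontal curve C = 0, so F is constant and the curve stays in Q. The third
condition is linear algebra: a basis adapted to the signature, a symplectic basis
(`exists_symplecticBasis`), or a rescaled basis (`exists_equiv_volume`). -/

namespace FlatAffine

/-! ### Coordinates on the bundle of frames. -/

section

variable {n : ℕ} {M : Type*} [TopologicalSpace M] [ChartedSpace (Vec n) M] [IsManifold (𝓡 n) ∞ M]

/-- The components of a tangent vector at `y` in the standard local frame around `x`. -/
def coframeAt (x y : M) : Tan (n := n) y →L[ℝ] Vec n :=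
  (trivializationAt (Vec n) (TangentSpace (𝓡 n) : M → Type _) x).continuousLinearMapAt ℝ y

lemma mem_baseSet_iff {x y : M} :
    y ∈ (trivializationAt (Vec n) (TangentSpace (𝓡 n) : M → Type _) x).baseSet ↔
      y ∈ (extChartAt (𝓡 n) x).source := by
  simp

lemma coframeAt_frameAt {x y : M} (hy : y ∈ (extChartAt (𝓡 n) x).source) (v : Vec n) :
    coframeAt x y (frameAt n x y v) = v :=
  Trivialization.continuousLinearMapAt_symmL _ (mem_baseSet_iff.2 hy) v

lemma frameAt_coframeAt {x y : M} (hy : y ∈ (extChartAt (𝓡 n) x).source) (v : Tan (n := n) y) :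
    frameAt n x y (coframeAt x y v) = v :=
  Trivialization.symmL_continuousLinearMapAt _ (mem_baseSet_iff.2 hy) v

/-- The standard local frame, as a linear isomorphism. -/
def frameEquiv {x y : M} (hy : y ∈ (extChartAt (𝓡 n) x).source) : Vec n ≃L[ℝ] Tan (n := n) y :=
  ContinuousLinearEquiv.equivOfInverse (frameAt n x y) (coframeAt x y)
    (coframeAt_frameAt hy) (frameAt_coframeAt hy)

/-- The parametrization of `FrameHom n M` over the chart around `x`. -/
def ofCoord (x : M) (p : Vec n × Gl n) : FrameHom n M :=
  ⟨(extChartAt (𝓡 n) x).symm p.1, (frameAt n x ((extChartAt (𝓡 n) x).symm p.1)).comp p.2⟩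

/-- The coordinates of a point of `FrameHom n M` in the chart around `x`. -/
def toCoord (x : M) (u : FrameHom n M) : Vec n × Gl n :=
  (extChartAt (𝓡 n) x u.proj, (coframeAt x u.proj).comp (fr u))

/-- The bundle chart at `u₀` depends on `u₀` only through its base point. Keeping `x` apart from
`u₀` allows the chart to be taken at the zero map over `x`. -/
lemma extChartAt_source_frameHom (x : M) (u₀ : FrameHom n M) (h : u₀.proj = x) :
    (extChartAt (FrameModel n) u₀).source = {u | u.proj ∈ (extChartAt (𝓡 n) x).source} := by
  subst h
  ext u
  rw [FiberBundle.extChartAt]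
  simp only [mfld_simps]
  exact ⟨fun h ↦ h.1.2, fun h ↦ ⟨⟨trivial, h⟩, h⟩⟩

lemma extChartAt_target_frameHom (x : M) (u₀ : FrameHom n M) (h : u₀.proj = x) :
    (extChartAt (FrameModel n) u₀).target = (extChartAt (𝓡 n) x).target ×ˢ univ := by
  subst h
  rw [FiberBundle.extChartAt_target]
  congr 1
  apply inter_eq_left.2
  intro z hz
  have := (extChartAt (𝓡 n) u₀.proj).map_target hz
  simpa using this

lemma extChartAt_frameHom (x : M) (u₀ : FrameHom n M) (h : u₀.proj = x) (u : FrameHom n M)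
    (hu : u.proj ∈ (extChartAt (𝓡 n) x).source) :
    extChartAt (FrameModel n) u₀ u = toCoord x u := by
  subst h
  rw [FiberBundle.extChartAt]
  -- The chart of a Hom bundle composes with the trivializations of both factors; the one of the
  -- trivial bundle is the identity and drops out.
  have h : (trivializationAt (Vec n) (Trivial M (Vec n)) u₀.proj).symmL ℝ u.proj =
      ContinuousLinearMap.id ℝ (Vec n) := by
    ext1 v
    simp
  refine Prod.ext rfl ?_
  change (coframeAt u₀.proj u.proj).comp ((fr u).comp
    ((trivializationAt (Vec n) (Trivial M (Vec n)) u₀.proj).symmL ℝ u.proj)) = _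
  rw [h]
  rfl

lemma toCoord_ofCoord {x : M} {p : Vec n × Gl n} (hp : p.1 ∈ (extChartAt (𝓡 n) x).target) :
    toCoord x (ofCoord x p) = p := by
  have h := (extChartAt (𝓡 n) x).map_target hp
  ext1
  · exact (extChartAt (𝓡 n) x).right_inv hp
  · ext1 v
    exact coframeAt_frameAt h _

lemma ofCoord_toCoord {x : M} {u : FrameHom n M} (hu : u.proj ∈ (extChartAt (𝓡 n) x).source) :
    ofCoord x (toCoord x u) = u := by
  -- The two base points agree only propositionally, so the fibre parts are compared by `HEq`.
  have key : ∀ (y : M) (A : Vec n →L[ℝ] Tan (n := n) y), y = u.proj →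
      (∀ v, HEq (A v) (fr u v)) → (⟨y, A⟩ : FrameHom n M) = u := by
    rintro y A rfl hA
    have : A = fr u := by ext1 v; exact eq_of_heq (hA v)
    rw [this]; rfl
  apply key
  · exact (extChartAt (𝓡 n) x).left_inv hu
  · intro v
    have e : (extChartAt (𝓡 n) x).symm (toCoord x u).1 = u.proj := (extChartAt (𝓡 n) x).left_inv hu
    have e' := frameAt_coframeAt hu (fr u v)
    have : HEq (frameAt n x ((extChartAt (𝓡 n) x).symm (toCoord x u).1) (coframeAt x u.proj (fr u v)))
      (frameAt n x u.proj (coframeAt x u.proj (fr u v))) := by rw [e]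
    exact this.trans (heq_of_eq e')

lemma extChartAt_symm_frameHom (x : M) (u₀ : FrameHom n M) (h : u₀.proj = x) {p : Vec n × Gl n}
    (hp : p.1 ∈ (extChartAt (𝓡 n) x).target) :
    (extChartAt (FrameModel n) u₀).symm p = ofCoord x p := by
  have hp' : p ∈ (extChartAt (FrameModel n) u₀).target := by
    rw [extChartAt_target_frameHom x u₀ h]; exact ⟨hp, mem_univ _⟩
  have hs : (ofCoord x p).proj ∈ (extChartAt (𝓡 n) x).source := (extChartAt (𝓡 n) x).map_target hp
  apply (extChartAt (FrameModel n) u₀).injOn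
  · exact (extChartAt (FrameModel n) u₀).map_target hp'
  · rw [extChartAt_source_frameHom x u₀ h]; exact hs
  · rw [(extChartAt (FrameModel n) u₀).right_inv hp', extChartAt_frameHom x u₀ h _ hs,
      toCoord_ofCoord hp]

lemma contMDiffOn_toCoord (x : M) :
    ContMDiffOn (FrameModel n) 𝓘(ℝ, Vec n × Gl n) ∞ (toCoord x)
      {u : FrameHom n M | u.proj ∈ (extChartAt (𝓡 n) x).source} := by
  have h := contMDiffOn_extChartAt (I := FrameModel n) (n := ∞) (x := (⟨x, 0⟩ : FrameHom n M))
  rw [← extChartAt_source (FrameModel n), extChartAt_source_frameHom x _ rfl] at h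
  exact h.congr fun u hu ↦ (extChartAt_frameHom x _ rfl u hu).symm

lemma contMDiffOn_ofCoord (x : M) :
    ContMDiffOn 𝓘(ℝ, Vec n × Gl n) (FrameModel n) ∞ (ofCoord x)
      ((extChartAt (𝓡 n) x).target ×ˢ univ) := by
  have h := contMDiffOn_extChartAt_symm (I := FrameModel n) (n := ∞) (⟨x, 0⟩ : FrameHom n M)
  rw [extChartAt_target_frameHom x _ rfl] at h
  exact h.congr fun p hp ↦ (extChartAt_symm_frameHom x _ rfl hp.1).symm

lemma isOpen_target_prod (x : M) :
    IsOpen ((extChartAt (𝓡 n) x).target ×ˢ (univ : Set (Gl n))) :=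
  (isOpen_extChartAt_target x).prod isOpen_univ

lemma isOpen_source_frameHom (x : M) :
    IsOpen {u : FrameHom n M | u.proj ∈ (extChartAt (𝓡 n) x).source} :=
  (isOpen_extChartAt_source (I := 𝓡 n) x).preimage (contMDiff_proj (IB := 𝓡 n) (n := ∞) _).continuous

lemma contMDiffAt_ofCoord {x : M} {p : Vec n × Gl n} (hp : p.1 ∈ (extChartAt (𝓡 n) x).target) :
    ContMDiffAt 𝓘(ℝ, Vec n × Gl n) (FrameModel n) ∞ (ofCoord x) p :=
  (contMDiffOn_ofCoord x).contMDiffAt ((isOpen_target_prod x).mem_nhds ⟨hp, mem_univ _⟩)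

lemma contMDiffAt_toCoord {x : M} {u : FrameHom n M} (hu : u.proj ∈ (extChartAt (𝓡 n) x).source) :
    ContMDiffAt (FrameModel n) 𝓘(ℝ, Vec n × Gl n) ∞ (toCoord x) u :=
  (contMDiffOn_toCoord x).contMDiffAt ((isOpen_source_frameHom x).mem_nhds hu)

/-- The differential of the parametrization `ofCoord`. -/
def dofCoord (x : M) (p : Vec n × Gl n) : Vec n × Gl n →L[ℝ] TanP (ofCoord x p) :=
  mfderiv 𝓘(ℝ, Vec n × Gl n) (FrameModel n) (ofCoord x) p

/-- The differential of the chart `toCoord`. -/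
def dtoCoord (x : M) (u : FrameHom n M) : TanP u →L[ℝ] Vec n × Gl n :=
  mfderiv (FrameModel n) 𝓘(ℝ, Vec n × Gl n) (toCoord x) u

lemma hasMFDerivAt_ofCoord {x : M} {p : Vec n × Gl n} (hp : p.1 ∈ (extChartAt (𝓡 n) x).target) :
    HasMFDerivAt 𝓘(ℝ, Vec n × Gl n) (FrameModel n) (ofCoord x) p (dofCoord x p) :=
  ((contMDiffAt_ofCoord hp).mdifferentiableAt (by simp)).hasMFDerivAt

lemma hasMFDerivAt_toCoord {x : M} {u : FrameHom n M}
    (hu : u.proj ∈ (extChartAt (𝓡 n) x).source) :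
    HasMFDerivAt (FrameModel n) 𝓘(ℝ, Vec n × Gl n) (toCoord x) u (dtoCoord x u) :=
  ((contMDiffAt_toCoord hu).mdifferentiableAt (by simp)).hasMFDerivAt

lemma dtoCoord_dofCoord {x : M} {p : Vec n × Gl n} (hp : p.1 ∈ (extChartAt (𝓡 n) x).target)
    (w : Vec n × Gl n) : dtoCoord x (ofCoord x p) (dofCoord x p w) = w := by
  have hs : (ofCoord x p).proj ∈ (extChartAt (𝓡 n) x).source := (extChartAt (𝓡 n) x).map_target hp
  have h := (hasMFDerivAt_toCoord hs).comp p (hasMFDerivAt_ofCoord hp)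
  have h' : HasMFDerivAt 𝓘(ℝ, Vec n × Gl n) 𝓘(ℝ, Vec n × Gl n) (toCoord x ∘ ofCoord x) p
      (ContinuousLinearMap.id ℝ (Vec n × Gl n)) := by
    refine (hasMFDerivAt_id p).congr_of_eventuallyEq ?_
    filter_upwards [(isOpen_target_prod x).mem_nhds ⟨hp, mem_univ _⟩] with q hq
    exact toCoord_ofCoord hq.1
  have := hasMFDerivAt_unique h h'
  exact congrArg (fun L : Vec n × Gl n →L[ℝ] Vec n × Gl n ↦ L w) this

lemma dofCoord_dtoCoord {x : M} {p : Vec n × Gl n} (hp : p.1 ∈ (extChartAt (𝓡 n) x).target)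
    (Z : TanP (ofCoord x p)) : dofCoord x p (dtoCoord x (ofCoord x p) Z) = Z := by
  have hs : (ofCoord x p).proj ∈ (extChartAt (𝓡 n) x).source := (extChartAt (𝓡 n) x).map_target hp
  have e : toCoord x (ofCoord x p) = p := toCoord_ofCoord hp
  have h := HasMFDerivAt.comp (ofCoord x p) (g := ofCoord x) (g' := dofCoord x p)
    (by rw [e]; exact hasMFDerivAt_ofCoord hp) (hasMFDerivAt_toCoord hs)
  have h' : HasMFDerivAt (FrameModel n) (FrameModel n) (ofCoord x ∘ toCoord x) (ofCoord x p)
      (ContinuousLinearMap.id ℝ (TanP (ofCoord x p))) := by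
    refine (hasMFDerivAt_id _).congr_of_eventuallyEq ?_
    filter_upwards [(isOpen_source_frameHom x).mem_nhds hs] with q hq
    exact ofCoord_toCoord hq
  have := hasMFDerivAt_unique h h'
  exact congrArg (fun L : TanP (ofCoord x p) →L[ℝ] TanP (ofCoord x p) ↦ L Z) this

/-- The differential of the parametrization, as a linear isomorphism. -/
def dofCoordEquiv {x : M} {p : Vec n × Gl n} (hp : p.1 ∈ (extChartAt (𝓡 n) x).target) :
    (Vec n × Gl n) ≃L[ℝ] TanP (ofCoord x p) :=
  ContinuousLinearEquiv.equivOfInverse (dofCoord x p) (dtoCoord x (ofCoord x p))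
    (dtoCoord_dofCoord hp) (dofCoord_dtoCoord hp)

end

/-! ### The connection form and η in coordinates. -/

section

variable {n : ℕ} {M : Type*} [TopologicalSpace M] [ChartedSpace (Vec n) M] [IsManifold (𝓡 n) ∞ M]

lemma hasDerivAt_mul_exp_smul {E : Type*} [NormedAddCommGroup E] [NormedSpace ℝ E]
    [CompleteSpace E] (a B : E →L[ℝ] E) :
    HasDerivAt (fun t : ℝ ↦ a * NormedSpace.exp (t • B)) (a * B) 0 := by
  have := hasDerivAt_exp_smul_const (𝕂 := ℝ) B (0 : ℝ)
  simp only [zero_smul, NormedSpace.exp_zero, one_mul] at this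
  exact this.const_mul a

lemma mul_exp_zero_smul {E : Type*} [NormedAddCommGroup E] [NormedSpace ℝ E]
    [CompleteSpace E] (a B : E →L[ℝ] E) :
    a * NormedSpace.exp ((0 : ℝ) • B) = a := by
  simp

lemma ofCoord_mem_LM_iff {x : M} {p : Vec n × Gl n} (hp : p.1 ∈ (extChartAt (𝓡 n) x).target) :
    ofCoord x p ∈ LM n M ↔ p.2.IsInvertible := by
  have hs := (extChartAt (𝓡 n) x).map_target hp
  constructor
  · rintro ⟨A, hA⟩
    refine ⟨A.trans (frameEquiv hs).symm, ?_⟩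
    ext1 v
    have h := congrArg (fun L : Vec n →L[ℝ] Tan (n := n) (ofCoord x p).proj ↦ L v) hA
    change coframeAt x ((extChartAt (𝓡 n) x).symm p.1) (A v) = _
    refine (congrArg (coframeAt x ((extChartAt (𝓡 n) x).symm p.1)) h).trans ?_
    exact coframeAt_frameAt hs _
  · rintro ⟨g, hg⟩
    refine ⟨g.trans (frameEquiv hs), ?_⟩
    ext1 v
    change frameAt n x _ (g v) = frameAt n x _ (p.2 v)
    rw [← hg]; rfl

/-- The trivialization of the tangent bundle around `x` is the tangent map of the chart, so the
standard local frame is the coordinate frame. Components in that frame and pullback by the chart are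
then the same thing. -/
lemma mfderiv_extChartAt_symm {x : M} {z : Vec n} (hz : z ∈ (extChartAt (𝓡 n) x).target) :
    HasMFDerivAt 𝓘(ℝ, Vec n) (𝓡 n) (extChartAt (𝓡 n) x).symm z
      (frameAt n x ((extChartAt (𝓡 n) x).symm z)) := by
  have hs := (extChartAt (𝓡 n) x).map_target hz
  have h := TangentBundle.symmL_trivializationAt (I := 𝓡 n) (x₀ := x)
    (x := (extChartAt (𝓡 n) x).symm z) (by rwa [extChartAt_source] at hs)
  rw [(extChartAt (𝓡 n) x).right_inv hz] at h
  have h' := (mdifferentiableWithinAt_extChartAt_symm hz).hasMFDerivWithinAt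
  rw [← h, ModelWithCorners.range_eq_univ] at h'
  exact hasMFDerivWithinAt_univ.1 h'

lemma mfderiv_extChartAt' {x y : M} (hy : y ∈ (extChartAt (𝓡 n) x).source) :
    HasMFDerivAt (𝓡 n) 𝓘(ℝ, Vec n) (extChartAt (𝓡 n) x) y (coframeAt x y) := by
  rw [extChartAt_source] at hy
  have h := TangentBundle.continuousLinearMapAt_trivializationAt (I := 𝓡 n) hy
  have h' := (mdifferentiableAt_extChartAt (I := 𝓡 n) hy).hasMFDerivAt
  rw [← h] at h'
  exact h'

lemma dproj_dofCoord {x : M} {p : Vec n × Gl n} (hp : p.1 ∈ (extChartAt (𝓡 n) x).target)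
    (w : Vec n × Gl n) :
    dproj (ofCoord x p) (dofCoord x p w) = frameAt n x ((extChartAt (𝓡 n) x).symm p.1) w.1 := by
  have h₁ : HasMFDerivAt (FrameModel n) (𝓡 n) (TotalSpace.proj : FrameHom n M → M) (ofCoord x p)
      (dproj (ofCoord x p)) :=
    ((contMDiffAt_proj (n := ∞) _).mdifferentiableAt (by simp)).hasMFDerivAt
  have h := h₁.comp p (hasMFDerivAt_ofCoord hp)
  have h₂ := (mfderiv_extChartAt_symm hp).comp p
    (hasFDerivAt_fst (𝕜 := ℝ) (p := p)).hasMFDerivAt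
  have := hasMFDerivAt_unique h h₂
  exact congrArg (fun L : Vec n × Gl n →L[ℝ] Vec n ↦ L w) this

lemma theta_dofCoord {x : M} {z : Vec n} (hz : z ∈ (extChartAt (𝓡 n) x).target)
    (g : Vec n ≃L[ℝ] Vec n) (v : Vec n) (b : Gl n) :
    theta (ofCoord x (z, (g : Gl n))) (dofCoord x (z, (g : Gl n)) (v, b)) = g.symm v := by
  have hs := (extChartAt (𝓡 n) x).map_target hz
  rw [theta, dproj_dofCoord (by exact hz)]
  have h : fr (ofCoord x (z, (g : Gl n))) = ((g.trans (frameEquiv hs) :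
      Vec n ≃L[ℝ] Tan (n := n) (ofCoord x (z, (g : Gl n))).proj) :
      Vec n →L[ℝ] Tan (n := n) (ofCoord x (z, (g : Gl n))).proj) := rfl
  change (fr (ofCoord x (z, (g : Gl n)))).inverse _ = _
  rw [h, ContinuousLinearMap.inverse_equiv]
  change g.symm (coframeAt x _ (frameAt n x _ v)) = _
  exact congrArg g.symm (coframeAt_frameAt hs v)

lemma rightMul_ofCoord (x : M) (z : Vec n) (a c : Gl n) :
    rightMul c (ofCoord x (z, a)) = ofCoord x (z, a * c) := rfl

lemma fundamental_ofCoord {x : M} {z : Vec n} (hz : z ∈ (extChartAt (𝓡 n) x).target)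
    (a B : Gl n) :
    fundamental B (ofCoord x (z, a)) = dofCoord x (z, a) (0, a * B) := by
  have h : HasDerivAt (fun t : ℝ ↦ (z, a * NormedSpace.exp (t • B))) (0, a * B) 0 :=
    (hasDerivAt_const _ _).prodMk (hasDerivAt_mul_exp_smul a B)
  have e : (z, a * NormedSpace.exp ((0 : ℝ) • B)) = (z, a) :=
    Prod.ext rfl (mul_exp_zero_smul a B)
  have h' := HasMFDerivAt.comp (0 : ℝ) (g := ofCoord x) (g' := dofCoord x (z, a))
    (by rw [e]; exact hasMFDerivAt_ofCoord (by exact hz)) h.hasFDerivAt.hasMFDerivAt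
  have h'' := h'.mfderiv
  have : fundamental B (ofCoord x (z, a)) = mfderiv 𝓘(ℝ, ℝ) (FrameModel n)
    (ofCoord x ∘ fun t : ℝ ↦ (z, a * NormedSpace.exp (t • B))) 0 (1 : ℝ) := rfl
  rw [this, h'']
  change dofCoord x (z, a) ((1 : ℝ) • (0, a * B)) = _
  rw [one_smul]

/-- In coordinates R_c is the linear map (z, a) ↦ (z, ac), which is its own derivative. -/
lemma mfderiv_rightMul_dofCoord {x : M} {z : Vec n} (hz : z ∈ (extChartAt (𝓡 n) x).target)
    (a c : Gl n) (v : Vec n) (b : Gl n) :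
    mfderiv (FrameModel n) (FrameModel n) (rightMul (M := M) c) (ofCoord x (z, a))
      (dofCoord x (z, a) (v, b)) = dofCoord x (z, a * c) (v, b * c) := by
  have hR : HasFDerivAt (fun q : Vec n × Gl n ↦ (q.1, q.2 * c))
      ((ContinuousLinearMap.fst ℝ (Vec n) (Gl n)).prod
        (((ContinuousLinearMap.compL ℝ (Vec n) (Vec n) (Vec n)).flip c).comp
          (ContinuousLinearMap.snd ℝ (Vec n) (Gl n)))) (z, a) :=
    ContinuousLinearMap.hasFDerivAt ((ContinuousLinearMap.fst ℝ (Vec n) (Gl n)).prod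
        (((ContinuousLinearMap.compL ℝ (Vec n) (Vec n) (Vec n)).flip c).comp
          (ContinuousLinearMap.snd ℝ (Vec n) (Gl n))))
  have hz' : (z, a).1 ∈ (extChartAt (𝓡 n) x).target := hz
  have h₁ : HasMFDerivAt 𝓘(ℝ, Vec n × Gl n) (FrameModel n)
      (ofCoord x ∘ fun q : Vec n × Gl n ↦ (q.1, q.2 * c)) (z, a) _ :=
    HasMFDerivAt.comp (z, a) (g := ofCoord x)
    (hasMFDerivAt_ofCoord (x := x) (p := (z, a * c)) (by exact hz)) hR.hasMFDerivAt
  have h₂ : HasMFDerivAt (FrameModel n) (FrameModel n) (rightMul (M := M) c) (ofCoord x (z, a))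
      ((mfderiv 𝓘(ℝ, Vec n × Gl n) (FrameModel n)
      (ofCoord x ∘ fun q : Vec n × Gl n ↦ (q.1, q.2 * c)) (z, a)).comp
        (dtoCoord x (ofCoord x (z, a)))) := by
    have hs : (ofCoord x (z, a)).proj ∈ (extChartAt (𝓡 n) x).source :=
      (extChartAt (𝓡 n) x).map_target hz
    have := HasMFDerivAt.comp (ofCoord x (z, a))
      (g := ofCoord x ∘ fun q : Vec n × Gl n ↦ (q.1, q.2 * c))
      (g' := mfderiv 𝓘(ℝ, Vec n × Gl n) (FrameModel n)
        (ofCoord x ∘ fun q : Vec n × Gl n ↦ (q.1, q.2 * c)) (z, a))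
      (by rw [toCoord_ofCoord hz']; exact h₁.mdifferentiableAt.hasMFDerivAt)
      (hasMFDerivAt_toCoord hs)
    refine this.congr_of_eventuallyEq ?_
    filter_upwards [(isOpen_source_frameHom x).mem_nhds hs] with q hq
    have := ofCoord_toCoord hq
    exact (congrArg (rightMul c) this).symm
  rw [h₂.mfderiv, h₁.mfderiv]
  change dofCoord x (z, a * c) (_, _) = _
  congr 1
  have := dtoCoord_dofCoord hz' (v, b)
  exact congrArg (fun q : Vec n × Gl n ↦ (q.1, q.2 * c)) this

/-- The pullback of the connection form along the standard local frame around `x`, read in the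
chart around `x`. -/
def LinearConnection.coeff (Γ : LinearConnection n M) (x : M) (z : Vec n) : Vec n →L[ℝ] Gl n :=
  (Γ.form (ofCoord x (z, 1))).comp
    ((dofCoord x (z, 1)).comp (ContinuousLinearMap.inl ℝ (Vec n) (Gl n)))

/-- The two axioms of a connection form determine it from its values on one section. The vertical
vector (0, b) at (z, g) is the fundamental vector of g⁻¹b; the vector (v, 0) at (z, g) is the image
under R_g of (v, 0) at (z, 1), so equivariance gives g⁻¹A(v)g. -/
lemma LinearConnection.form_dofCoord (Γ : LinearConnection n M) {x : M} {z : Vec n}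
    (hz : z ∈ (extChartAt (𝓡 n) x).target) (g : Vec n ≃L[ℝ] Vec n) (v : Vec n) (b : Gl n) :
    Γ.form (ofCoord x (z, (g : Gl n))) (dofCoord x (z, (g : Gl n)) (v, b)) =
      (g.symm : Gl n) * (Γ.coeff x z v * g + b) := by
  have hg : (g : Gl n) * (g.symm : Gl n) = 1 := by ext1 w; simp
  have e : ((v, b) : Vec n × Gl n) = (v, 0) + (0, (g : Gl n) * ((g.symm : Gl n) * b)) := by
    rw [← mul_assoc, hg]; simp
  have h₁ := Γ.form_fundamental (ofCoord x (z, (g : Gl n)))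
    ((ofCoord_mem_LM_iff (by exact hz)).2 ⟨g, rfl⟩) ((g.symm : Gl n) * b)
  rw [fundamental_ofCoord hz] at h₁
  have h₂ := Γ.equivariant (ofCoord x (z, 1))
    ((ofCoord_mem_LM_iff (by exact hz)).2 ⟨ContinuousLinearEquiv.refl ℝ _, rfl⟩) g
    (dofCoord x (z, 1) (v, 0))
  rw [mfderiv_rightMul_dofCoord hz, rightMul_ofCoord, zero_mul, one_mul] at h₂
  rw [e]
  have h₃ := (dofCoord x (z, (g : Gl n))).map_add (v, 0) (0, (g : Gl n) * ((g.symm : Gl n) * b))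
  refine (congrArg (Γ.form (ofCoord x (z, (g : Gl n)))) h₃).trans ?_
  refine ((Γ.form (ofCoord x (z, (g : Gl n)))).map_add _ _).trans ?_
  rw [h₁, h₂, mul_add, mul_assoc]
  rfl

lemma LinearConnection.eta_dofCoord (Γ : LinearConnection n M) {x : M} {z : Vec n}
    (hz : z ∈ (extChartAt (𝓡 n) x).target) (g : Vec n ≃L[ℝ] Vec n) (v : Vec n) (b : Gl n) :
    Γ.eta (ofCoord x (z, (g : Gl n))) (dofCoord x (z, (g : Gl n)) (v, b)) =
      ⟨g.symm v, (g.symm : Gl n) * (Γ.coeff x z v * g + b)⟩ := by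
  rw [LinearConnection.eta, theta_dofCoord hz, Γ.form_dofCoord hz]

end

section

/-! ### Pulling back vector fields by parametrizations -/

section Pull

variable {E E' : Type*} [NormedAddCommGroup E] [NormedSpace ℝ E] [CompleteSpace E]
  [NormedAddCommGroup E'] [NormedSpace ℝ E'] [CompleteSpace E']
  {H : Type*} [TopologicalSpace H] {I : ModelWithCorners ℝ E' H}
  {N : Type*} [TopologicalSpace N] [ChartedSpace H N] [IsManifold I ∞ N]

/-- The pullback of a vector field by a parametrization. -/
def pullField (I : ModelWithCorners ℝ E' H) (f : E → N) (Z : ∀ u : N, TangentSpace I u) (p : E) :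
    E :=
  (mfderiv 𝓘(ℝ, E) I f p).inverse (Z (f p))

/-- The vector field with given expression in a chart. -/
def pushField (I : ModelWithCorners ℝ E' H) (f : N → E) (G : E → E) (u : N) : TangentSpace I u :=
  (mfderiv I 𝓘(ℝ, E) f u).inverse (G (f u))

lemma contDiffAt_pullField {f : E → N} {Z : ∀ u : N, TangentSpace I u} {p : E}
    (hZ : ContMDiffAt I I.tangent ∞ (fun u ↦ (⟨u, Z u⟩ : TangentBundle I N)) (f p))
    (hf : ContMDiffAt 𝓘(ℝ, E) I ∞ f p) (hf' : (mfderiv 𝓘(ℝ, E) I f p).IsInvertible) :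
    ContDiffAt ℝ ∞ (pullField I f Z) p := by
  have h := ContMDiffAt.mpullback_vectorField_preimage (n := ∞) hZ hf hf' (by simp)
  exact contMDiffAt_vectorSpace_iff_contDiffAt.1 h

lemma contMDiffAt_pushField {f : N → E} {G : E → E} {u : N}
    (hG : ContDiffAt ℝ ∞ G (f u)) (hf : ContMDiffAt I 𝓘(ℝ, E) ∞ f u)
    (hf' : (mfderiv I 𝓘(ℝ, E) f u).IsInvertible) :
    ContMDiffAt I I.tangent ∞ (fun u ↦ (⟨u, pushField I f G u⟩ : TangentBundle I N)) u :=
  ContMDiffAt.mpullback_vectorField_preimage (n := ∞)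
    (contMDiffAt_vectorSpace_iff_contDiffAt.2 hG) hf hf' (by simp)

lemma pullField_mlieBracket {f : E → N} {Z W : ∀ u : N, TangentSpace I u} {p : E}
    (hZ : ContMDiffAt I I.tangent ∞ (fun u ↦ (⟨u, Z u⟩ : TangentBundle I N)) (f p))
    (hW : ContMDiffAt I I.tangent ∞ (fun u ↦ (⟨u, W u⟩ : TangentBundle I N)) (f p))
    (hf : ContMDiffAt 𝓘(ℝ, E) I ∞ f p) :
    pullField I f (VectorField.mlieBracket I Z W) p =
      VectorField.lieBracket ℝ (pullField I f Z) (pullField I f W) p := by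
  have h₂ : minSmoothness ℝ 2 = 2 := minSmoothness_of_isRCLikeNormedField
  have : IsManifold I (minSmoothness ℝ 2) N := by rw [h₂]; infer_instance
  have : IsManifold 𝓘(ℝ, E) (minSmoothness ℝ 2) E := by rw [h₂]; infer_instance
  have h := VectorField.mpullback_mlieBracket (n := ∞) (hZ.mdifferentiableAt (by simp))
    (hW.mdifferentiableAt (by simp)) hf (by rw [h₂]; exact WithTop.coe_le_coe.2 (le_top : (2 : ℕ∞) ≤ ⊤))
  have e := congrFun (VectorField.mlieBracketWithin_eq_lieBracketWithin
    (V := VectorField.mpullback 𝓘(ℝ, E) I f Z) (W := VectorField.mpullback 𝓘(ℝ, E) I f W)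
    (s := univ)) p
  rw [VectorField.mlieBracketWithin_univ] at e
  exact h.trans (e.trans (congrFun (VectorField.lieBracketWithin_univ (𝕜 := ℝ)
    (V := pullField I f Z) (W := pullField I f W)) p))

end Pull

variable {n : ℕ} {M : Type*} [TopologicalSpace M] [ChartedSpace (Vec n) M] [IsManifold (𝓡 n) ∞ M]

/-! ### Vector fields on the manifold of frames in coordinates -/

/-- The vector field on the manifold of frames with given expression in the chart around `x`. -/
def pushP (x : M) (G : Vec n × Gl n → Vec n × Gl n) (u : FrameHom n M) : TanP u :=
  pushField (FrameModel n) (toCoord x) G u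

/-- The expression in the chart around `x` of a vector field on the manifold of frames. -/
def pullP (x : M) (Z : ∀ u : FrameHom n M, TanP u) (p : Vec n × Gl n) : Vec n × Gl n :=
  pullField (FrameModel n) (ofCoord x) Z p

lemma mfderiv_ofCoord_eq {x : M} {p : Vec n × Gl n} (hp : p.1 ∈ (extChartAt (𝓡 n) x).target) :
    mfderiv 𝓘(ℝ, Vec n × Gl n) (FrameModel n) (ofCoord x) p =
      (dofCoordEquiv hp : Vec n × Gl n →L[ℝ] TanP (ofCoord x p)) := rfl

lemma mfderiv_toCoord_eq {x : M} {p : Vec n × Gl n} (hp : p.1 ∈ (extChartAt (𝓡 n) x).target) :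
    mfderiv (FrameModel n) 𝓘(ℝ, Vec n × Gl n) (toCoord x) (ofCoord x p) =
      ((dofCoordEquiv hp).symm : TanP (ofCoord x p) →L[ℝ] Vec n × Gl n) := rfl

lemma pushP_ofCoord {x : M} {p : Vec n × Gl n} (hp : p.1 ∈ (extChartAt (𝓡 n) x).target)
    (G : Vec n × Gl n → Vec n × Gl n) : pushP x G (ofCoord x p) = dofCoord x p (G p) := by
  have h : pushP x G (ofCoord x p) =
      (mfderiv (FrameModel n) 𝓘(ℝ, Vec n × Gl n) (toCoord x) (ofCoord x p)).inverse
        (G (toCoord x (ofCoord x p))) := rfl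
  have h' : (mfderiv (FrameModel n) 𝓘(ℝ, Vec n × Gl n) (toCoord x) (ofCoord x p)).inverse =
      dofCoord x p := by
    rw [mfderiv_toCoord_eq hp]
    exact ContinuousLinearMap.inverse_equiv (dofCoordEquiv hp).symm
  rw [h, h', toCoord_ofCoord hp]
  rfl

lemma pullP_apply {x : M} {p : Vec n × Gl n} (hp : p.1 ∈ (extChartAt (𝓡 n) x).target)
    (Z : ∀ u : FrameHom n M, TanP u) : pullP x Z p = dtoCoord x (ofCoord x p) (Z (ofCoord x p)) := by
  have h : pullP x Z p =
      (mfderiv 𝓘(ℝ, Vec n × Gl n) (FrameModel n) (ofCoord x) p).inverse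
        (Z (ofCoord x p)) := rfl
  rw [h, mfderiv_ofCoord_eq hp]
  exact congrArg (fun L : TanP (ofCoord x p) →L[ℝ] Vec n × Gl n ↦ L (Z (ofCoord x p)))
    (ContinuousLinearMap.inverse_equiv (dofCoordEquiv hp))

lemma dofCoord_pullP {x : M} {p : Vec n × Gl n} (hp : p.1 ∈ (extChartAt (𝓡 n) x).target)
    (Z : ∀ u : FrameHom n M, TanP u) : dofCoord x p (pullP x Z p) = Z (ofCoord x p) := by
  rw [pullP_apply hp, dofCoord_dtoCoord hp]

lemma isInvertible_mfderiv_ofCoord {x : M} {p : Vec n × Gl n}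
    (hp : p.1 ∈ (extChartAt (𝓡 n) x).target) :
    (mfderiv 𝓘(ℝ, Vec n × Gl n) (FrameModel n) (ofCoord x) p).IsInvertible :=
  ⟨dofCoordEquiv hp, rfl⟩

lemma isInvertible_mfderiv_toCoord {x : M} {u : FrameHom n M}
    (hu : u.proj ∈ (extChartAt (𝓡 n) x).source) :
    (mfderiv (FrameModel n) 𝓘(ℝ, Vec n × Gl n) (toCoord x) u).IsInvertible := by
  have hp : (toCoord x u).1 ∈ (extChartAt (𝓡 n) x).target := (extChartAt (𝓡 n) x).map_source hu
  have h : (mfderiv (FrameModel n) 𝓘(ℝ, Vec n × Gl n) (toCoord x)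
      (ofCoord x (toCoord x u))).IsInvertible := ⟨(dofCoordEquiv hp).symm, rfl⟩
  rwa [ofCoord_toCoord hu] at h

lemma smoothFieldPOn_pushP (x : M) {G : Vec n × Gl n → Vec n × Gl n} {S : Set (Vec n × Gl n)}
    (hS : IsOpen S) (hG : ContDiffOn ℝ ∞ G S) :
    SmoothFieldPOn ({u : FrameHom n M | u.proj ∈ (extChartAt (𝓡 n) x).source} ∩ toCoord x ⁻¹' S)
      (pushP x G) := by
  rintro u ⟨hu, hu'⟩
  exact (contMDiffAt_pushField (hG.contDiffAt (hS.mem_nhds hu')) (contMDiffAt_toCoord hu)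
    (isInvertible_mfderiv_toCoord hu)).contMDiffWithinAt

lemma contDiffAt_pullP {x : M} {Z : ∀ u : FrameHom n M, TanP u} {U : Set (FrameHom n M)}
    (hU : IsOpen U) (hZ : SmoothFieldPOn U Z) {p : Vec n × Gl n}
    (hp : p.1 ∈ (extChartAt (𝓡 n) x).target) (hp' : ofCoord x p ∈ U) :
    ContDiffAt ℝ ∞ (pullP x Z) p :=
  contDiffAt_pullField (hZ.contMDiffAt (hU.mem_nhds hp'))
    (contMDiffAt_ofCoord hp) (isInvertible_mfderiv_ofCoord hp)

lemma pullP_mlieBracket {x : M} {Z W : ∀ u : FrameHom n M, TanP u} {U : Set (FrameHom n M)}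
    (hU : IsOpen U) (hZ : SmoothFieldPOn U Z) (hW : SmoothFieldPOn U W) {p : Vec n × Gl n}
    (hp : p.1 ∈ (extChartAt (𝓡 n) x).target) (hp' : ofCoord x p ∈ U) :
    pullP x (VectorField.mlieBracket (FrameModel n) Z W) p =
      VectorField.lieBracket ℝ (pullP x Z) (pullP x W) p :=
  pullField_mlieBracket (hZ.contMDiffAt (hU.mem_nhds hp')) (hW.contMDiffAt (hU.mem_nhds hp'))
    (contMDiffAt_ofCoord hp)

/-! ### Vector fields on the base in coordinates -/

/-- The vector field on `M` with given components in the chart around `x`. -/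
def pushM (x : M) (f : Vec n → Vec n) (y : M) : Tan (n := n) y :=
  pushField (𝓡 n) (extChartAt (𝓡 n) x) f y

/-- The components in the chart around `x` of a vector field on `M`. -/
def pullM (x : M) (Y : ∀ y : M, Tan (n := n) y) (z : Vec n) : Vec n :=
  pullField (𝓡 n) (extChartAt (𝓡 n) x).symm Y z

lemma pushM_apply {x y : M} (hy : y ∈ (extChartAt (𝓡 n) x).source) (f : Vec n → Vec n) :
    pushM x f y = frameAt n x y (f (extChartAt (𝓡 n) x y)) := by
  have h : pushM x f y = (mfderiv (𝓡 n) 𝓘(ℝ, Vec n) (extChartAt (𝓡 n) x) y).inverse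
      (f (extChartAt (𝓡 n) x y)) := rfl
  have e : mfderiv (𝓡 n) 𝓘(ℝ, Vec n) (extChartAt (𝓡 n) x) y = ((frameEquiv hy).symm :
      Tan (n := n) y →L[ℝ] Vec n) := (mfderiv_extChartAt' hy).mfderiv
  rw [h, e]
  exact congrArg (fun L : Vec n →L[ℝ] Tan (n := n) y ↦ L (f (extChartAt (𝓡 n) x y)))
    (ContinuousLinearMap.inverse_equiv (frameEquiv hy).symm)

lemma pullM_apply {x : M} {z : Vec n} (hz : z ∈ (extChartAt (𝓡 n) x).target)
    (Y : ∀ y : M, Tan (n := n) y) :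
    pullM x Y z = coframeAt x ((extChartAt (𝓡 n) x).symm z) (Y ((extChartAt (𝓡 n) x).symm z)) := by
  have hs := (extChartAt (𝓡 n) x).map_target hz
  have h : pullM x Y z = (mfderiv 𝓘(ℝ, Vec n) (𝓡 n) (extChartAt (𝓡 n) x).symm z).inverse
      (Y ((extChartAt (𝓡 n) x).symm z)) := rfl
  have e : mfderiv 𝓘(ℝ, Vec n) (𝓡 n) (extChartAt (𝓡 n) x).symm z = (frameEquiv hs :
      Vec n →L[ℝ] Tan (n := n) ((extChartAt (𝓡 n) x).symm z)) := (mfderiv_extChartAt_symm hz).mfderiv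
  rw [h, e]
  exact congrArg (fun L : Tan (n := n) ((extChartAt (𝓡 n) x).symm z) →L[ℝ] Vec n ↦
    L (Y ((extChartAt (𝓡 n) x).symm z))) (ContinuousLinearMap.inverse_equiv (frameEquiv hs))

lemma frameAt_pullM {x : M} {z : Vec n} (hz : z ∈ (extChartAt (𝓡 n) x).target)
    (Y : ∀ y : M, Tan (n := n) y) :
    frameAt n x ((extChartAt (𝓡 n) x).symm z) (pullM x Y z) = Y ((extChartAt (𝓡 n) x).symm z) := by
  rw [pullM_apply hz]
  exact frameAt_coframeAt ((extChartAt (𝓡 n) x).map_target hz) _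

lemma pullM_pushM {x : M} {z : Vec n} (hz : z ∈ (extChartAt (𝓡 n) x).target) (f : Vec n → Vec n) :
    pullM x (pushM x f) z = f z := by
  have hs := (extChartAt (𝓡 n) x).map_target hz
  rw [pullM_apply hz, pushM_apply hs, coframeAt_frameAt hs, (extChartAt (𝓡 n) x).right_inv hz]

lemma contMDiffAt_extChartAt_symm' {x : M} {z : Vec n} (hz : z ∈ (extChartAt (𝓡 n) x).target) :
    ContMDiffAt 𝓘(ℝ, Vec n) (𝓡 n) ∞ (extChartAt (𝓡 n) x).symm z :=
  (contMDiffOn_extChartAt_symm x).contMDiffAt ((isOpen_extChartAt_target x).mem_nhds hz)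

lemma contMDiffAt_pushM {x y : M} {f : Vec n → Vec n} (hy : y ∈ (extChartAt (𝓡 n) x).source)
    (hf : ContDiffAt ℝ ∞ f (extChartAt (𝓡 n) x y)) :
    ContMDiffAt (𝓡 n) (𝓡 n).tangent ∞
      (fun y ↦ (⟨y, pushM x f y⟩ : TangentBundle (𝓡 n) M)) y :=
  contMDiffAt_pushField hf (contMDiffAt_extChartAt' (by rwa [extChartAt_source] at hy))
    (isInvertible_mfderiv_extChartAt hy)

lemma smoothFieldOn_pushM (x : M) {f : Vec n → Vec n} (hf : ContDiff ℝ ∞ f) :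
    SmoothFieldOn (extChartAt (𝓡 n) x).source (pushM x f) :=
  fun _ hy ↦ (contMDiffAt_pushM hy hf.contDiffAt).contMDiffWithinAt

lemma isInvertible_mfderiv_extChartAt_symm {x : M} {z : Vec n}
    (hz : z ∈ (extChartAt (𝓡 n) x).target) :
    (mfderiv 𝓘(ℝ, Vec n) (𝓡 n) (extChartAt (𝓡 n) x).symm z).IsInvertible :=
  ⟨frameEquiv ((extChartAt (𝓡 n) x).map_target hz), (mfderiv_extChartAt_symm hz).mfderiv.symm⟩

lemma contDiffAt_pullM {x : M} {Y : ∀ y : M, Tan (n := n) y} {z : Vec n}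
    (hz : z ∈ (extChartAt (𝓡 n) x).target)
    (hY : ContMDiffAt (𝓡 n) (𝓡 n).tangent ∞ (fun y ↦ (⟨y, Y y⟩ : TangentBundle (𝓡 n) M))
      ((extChartAt (𝓡 n) x).symm z)) :
    ContDiffAt ℝ ∞ (pullM x Y) z :=
  contDiffAt_pullField hY
    (contMDiffAt_extChartAt_symm' hz) (isInvertible_mfderiv_extChartAt_symm hz)

lemma pullM_mlieBracket {x : M} {X Y : ∀ y : M, Tan (n := n) y} {z : Vec n}
    (hz : z ∈ (extChartAt (𝓡 n) x).target)
    (hX : ContMDiffAt (𝓡 n) (𝓡 n).tangent ∞ (fun y ↦ (⟨y, X y⟩ : TangentBundle (𝓡 n) M))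
      ((extChartAt (𝓡 n) x).symm z))
    (hY : ContMDiffAt (𝓡 n) (𝓡 n).tangent ∞ (fun y ↦ (⟨y, Y y⟩ : TangentBundle (𝓡 n) M))
      ((extChartAt (𝓡 n) x).symm z)) :
    pullM x (VectorField.mlieBracket (𝓡 n) X Y) z =
      VectorField.lieBracket ℝ (pullM x X) (pullM x Y) z :=
  pullField_mlieBracket hX hY (contMDiffAt_extChartAt_symm' hz)

/-! ### Smoothness of the connection coefficients -/

/-- Smoothness of ω is given by testing on smooth fields. The coordinate field (v, 0), restricted to
the section z ↦ (z, 1), gives smoothness for each fixed v, which is enough in finite dimension. -/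
lemma LinearConnection.contDiffOn_coeff (Γ : LinearConnection n M) (x : M) :
    ContDiffOn ℝ ∞ (Γ.coeff x) (extChartAt (𝓡 n) x).target := by
  rw [contDiffOn_clm_apply]
  intro v
  set U : Set (FrameHom n M) := {u | u.proj ∈ (extChartAt (𝓡 n) x).source} ∩ LM n M with hU
  have hUo : IsOpen U := (isOpen_source_frameHom x).inter isOpen_LM
  have hs := smoothFieldPOn_pushP x isOpen_univ (contDiffOn_const (c := ((v, 0) : Vec n × Gl n)))
  have h := Γ.smooth U (pushP x fun _ ↦ (v, 0)) hUo inter_subset_right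
    (hs.mono fun u hu ↦ ⟨hu.1, mem_univ _⟩)
  have hmem : ∀ z ∈ (extChartAt (𝓡 n) x).target, ofCoord x (z, 1) ∈ U := fun z hz ↦
    ⟨(extChartAt (𝓡 n) x).map_target hz,
      (ofCoord_mem_LM_iff (by exact hz)).2 ⟨ContinuousLinearEquiv.refl ℝ _, rfl⟩⟩
  have hc : ContMDiffOn 𝓘(ℝ, Vec n) (FrameModel n) ∞ (fun z : Vec n ↦ ofCoord x (z, 1))
      (extChartAt (𝓡 n) x).target := by
    refine (contMDiffOn_ofCoord x).comp (t := (extChartAt (𝓡 n) x).target ×ˢ univ)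
      (f := fun z : Vec n ↦ ((z, 1) : Vec n × Gl n)) ?_ fun z hz ↦ ⟨hz, mem_univ _⟩
    exact (contDiff_id.prodMk contDiff_const).contMDiff.contMDiffOn
  have h' := h.comp hc hmem
  refine h'.contDiffOn.congr fun z hz ↦ ?_
  have e := pushP_ofCoord (x := x) (p := (z, 1)) (by exact hz) fun _ ↦ (v, 0)
  exact (congrArg (Γ.form (ofCoord x (z, 1))) e).symm

end

/-! ### The covariant derivative in a fixed chart. -/

section

variable {n : ℕ} {M : Type*} [TopologicalSpace M] [ChartedSpace (Vec n) M] [IsManifold (𝓡 n) ∞ M]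

lemma mvfderiv_eq_of_hasFDerivAt {V : Type*} [NormedAddCommGroup V] [NormedSpace ℝ V] {x : M}
    {z : Vec n} (hz : z ∈ (extChartAt (𝓡 n) x).target) {f : M → V} {L : Vec n →L[ℝ] V}
    (h : HasFDerivAt (fun z ↦ f ((extChartAt (𝓡 n) x).symm z)) L z)
    (v : Tan (n := n) ((extChartAt (𝓡 n) x).symm z)) :
    mvfderiv (𝓡 n) f ((extChartAt (𝓡 n) x).symm z) v =
      L (coframeAt x ((extChartAt (𝓡 n) x).symm z) v) := by
  have hs := (extChartAt (𝓡 n) x).map_target hz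
  have e := (extChartAt (𝓡 n) x).right_inv hz
  have h₁ := HasMFDerivAt.comp ((extChartAt (𝓡 n) x).symm z)
    (g := fun z ↦ f ((extChartAt (𝓡 n) x).symm z)) (g' := L)
    (by rw [e]; exact h.hasMFDerivAt) (mfderiv_extChartAt' hs)
  have h₂ := h₁.congr_of_eventuallyEq (f₁ := f) (by
    filter_upwards [(isOpen_extChartAt_source (I := 𝓡 n) x).mem_nhds hs] with y hy
    exact congrArg f ((extChartAt (𝓡 n) x).left_inv hy).symm)
  have h₃ := h₂.mfderiv
  exact congrArg (fun L : Vec n →L[ℝ] V ↦ L v) h₃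

/-- The transition function from the standard local frame around `x` to the one around `y`. -/
def transition (x y : M) (z : Vec n) : Gl n :=
  (coframeAt x ((extChartAt (𝓡 n) x).symm z)).comp (frameAt n y ((extChartAt (𝓡 n) x).symm z))

lemma toCoord_localFrame {x y y' : M} (hy' : y' ∈ (extChartAt (𝓡 n) x).source) :
    toCoord x (localFrame n y y') =
      (extChartAt (𝓡 n) x y', transition x y (extChartAt (𝓡 n) x y')) := by
  refine Prod.ext rfl ?_
  change (coframeAt x y').comp (frameAt n y y') = _
  rw [transition, (extChartAt (𝓡 n) x).left_inv hy']

lemma localFrame_eq_ofCoord {y y' : M} (hy' : y' ∈ (extChartAt (𝓡 n) y).source) :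
    localFrame n y y' = ofCoord y (extChartAt (𝓡 n) y y', 1) := by
  have h : transition y y (extChartAt (𝓡 n) y y') = 1 := by
    ext1 v
    exact coframeAt_frameAt ((extChartAt (𝓡 n) y).map_target ((extChartAt (𝓡 n) y).map_source hy')) v
  rw [← h, ← toCoord_localFrame hy', ofCoord_toCoord hy']

lemma contMDiffAt_localFrame {y y' : M} (hy' : y' ∈ (extChartAt (𝓡 n) y).source) :
    ContMDiffAt (𝓡 n) (FrameModel n) ∞ (localFrame n y) y' := by
  have h₁ : ContMDiffAt (𝓡 n) 𝓘(ℝ, Vec n) ∞ (extChartAt (𝓡 n) y) y' :=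
    contMDiffAt_extChartAt' (by rwa [extChartAt_source] at hy')
  have h₂ : ContMDiffAt (𝓡 n) 𝓘(ℝ, Vec n × Gl n) ∞
      (fun w : M ↦ ((extChartAt (𝓡 n) y w, 1) : Vec n × Gl n)) y' :=
    ContMDiffAt.comp (g := fun z : Vec n ↦ ((z, 1) : Vec n × Gl n)) y'
      ((contDiff_id.prodMk contDiff_const).contMDiff.contMDiffAt) h₁
  have h₃ := ContMDiffAt.comp (g := ofCoord y) y'
    (contMDiffAt_ofCoord (by exact (extChartAt (𝓡 n) y).map_source hy')) h₂
  refine h₃.congr_of_eventuallyEq ?_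
  filter_upwards [(isOpen_extChartAt_source (I := 𝓡 n) y).mem_nhds hy'] with w hw
  exact localFrame_eq_ofCoord hw

lemma eventually_symm_mem_source {x y : M} {z : Vec n} (hz : z ∈ (extChartAt (𝓡 n) x).target)
    (hy : (extChartAt (𝓡 n) x).symm z ∈ (extChartAt (𝓡 n) y).source) :
    ∀ᶠ z' in 𝓝 z, z' ∈ (extChartAt (𝓡 n) x).target ∧
      (extChartAt (𝓡 n) x).symm z' ∈ (extChartAt (𝓡 n) y).source := by
  have hc := (contMDiffAt_extChartAt_symm' hz).continuousAt
  exact Filter.inter_mem ((isOpen_extChartAt_target x).mem_nhds hz)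
    (hc ((isOpen_extChartAt_source (I := 𝓡 n) y).mem_nhds hy))

lemma contDiffAt_transition {x y : M} {z : Vec n} (hz : z ∈ (extChartAt (𝓡 n) x).target)
    (hy : (extChartAt (𝓡 n) x).symm z ∈ (extChartAt (𝓡 n) y).source) :
    ContDiffAt ℝ ∞ (transition x y) z := by
  have hs := (extChartAt (𝓡 n) x).map_target hz
  have h₁ := ContMDiffAt.comp (g := localFrame n y) z (contMDiffAt_localFrame hy)
    (contMDiffAt_extChartAt_symm' hz)
  have h₂ := ContMDiffAt.comp (g := toCoord x) z (contMDiffAt_toCoord hs) h₁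
  have h₃ := h₂.contDiffAt.snd
  refine h₃.congr_of_eventuallyEq ?_
  filter_upwards [eventually_symm_mem_source hz hy] with z' hz'
  have e := toCoord_localFrame (y := y) ((extChartAt (𝓡 n) x).map_target hz'.1)
  rw [(extChartAt (𝓡 n) x).right_inv hz'.1] at e
  exact (congrArg Prod.snd e).symm

lemma LinearConnection.form_mfderiv (Γ : LinearConnection n M) {x y : M} {f : M → FrameHom n M}
    {k : M → Vec n × Gl n} {k' : Tan (n := n) y →L[ℝ] Vec n × Gl n}
    (hk : HasMFDerivAt (𝓡 n) 𝓘(ℝ, Vec n × Gl n) k y k')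
    (hky : (k y).1 ∈ (extChartAt (𝓡 n) x).target) (hf : f =ᶠ[𝓝 y] ofCoord x ∘ k)
    (v : Tan (n := n) y) :
    Γ.form (f y) (mfderiv (𝓡 n) (FrameModel n) f y v) =
      Γ.form (ofCoord x (k y)) (dofCoord x (k y) (k' v)) := by
  have h := (HasMFDerivAt.comp y (hasMFDerivAt_ofCoord hky) hk).congr_of_eventuallyEq hf
  have e₁ : (mfderiv (𝓡 n) (FrameModel n) f y : Vec n →L[ℝ] Vec n × Gl n) = _ := h.mfderiv
  -- Every `TanP u` unfolds to `Vec n × Gl n`, so the form can be evaluated on one vector at two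
  -- equal points without transport.
  have e₂ : ∀ u u' : FrameHom n M, u = u' → ∀ Z : Vec n × Gl n, Γ.form u Z = Γ.form u' Z := by
    rintro u _ rfl Z; rfl
  have e₃ := congrArg (fun L : Vec n →L[ℝ] Vec n × Gl n ↦ L v) e₁
  exact (congrArg (Γ.form (f y)) e₃).trans
    (e₂ _ _ hf.eq_of_nhds (dofCoord x (k y) (k' v)))

/-- The covariant derivative in coordinates. -/
lemma LinearConnection.nabla_apply (Γ : LinearConnection n M) {x : M} {z : Vec n}
    (hz : z ∈ (extChartAt (𝓡 n) x).target) {Y : ∀ y : M, Tan (n := n) y}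
    (hY : ContMDiffAt (𝓡 n) (𝓡 n).tangent ∞ (fun y ↦ (⟨y, Y y⟩ : TangentBundle (𝓡 n) M))
      ((extChartAt (𝓡 n) x).symm z)) :
    ∀ v : Tan (n := n) ((extChartAt (𝓡 n) x).symm z),
    Γ.nabla Y ((extChartAt (𝓡 n) x).symm z) v = frameAt n x ((extChartAt (𝓡 n) x).symm z)
      (fderiv ℝ (pullM x Y) z (coframeAt x _ v) +
        Γ.coeff x z (coframeAt x _ v) (pullM x Y z)) := by
  have hs := (extChartAt (𝓡 n) x).map_target hz
  have e := (extChartAt (𝓡 n) x).right_inv hz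
  set y : M := (extChartAt (𝓡 n) x).symm z with hy
  intro v
  have hyy : y ∈ (extChartAt (𝓡 n) y).source := mem_extChartAt_source (I := 𝓡 n) y
  have hYd : MDifferentiableAt (𝓡 n) (𝓡 n).tangent
      (fun y ↦ (⟨y, Y y⟩ : TangentBundle (𝓡 n) M)) y :=
    hY.mdifferentiableAt (by simp)
  have hcomp := mdifferentiableAt_components hYd
  -- By definition `nabla` at `y` uses the frame around `y`, which changes with the point. The
  -- passage to the fixed frame around `x` is the gauge transformation A ↦ h⁻¹(Ah + dh), with h the
  -- transition function and g its value at z.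
  set h : Vec n → Gl n := transition x y with hh
  have hhd : HasFDerivAt h (fderiv ℝ h z) z :=
    ((contDiffAt_transition hz hyy).differentiableAt (by simp)).hasFDerivAt
  let g : Vec n ≃L[ℝ] Vec n := (frameEquiv hyy).trans (frameEquiv hs).symm
  have hg : h z = (g : Gl n) := rfl
  -- the components in the frame around `y`, read in the chart around `x`
  set c : Vec n → Vec n := fun z' ↦ components y Y ((extChartAt (𝓡 n) x).symm z') with hc
  have hcd : HasFDerivAt c (fderiv ℝ c z) z := by
    have := MDifferentiableAt.comp (g := components y Y) z hcomp
      (contMDiffAt_extChartAt_symm' hz |>.mdifferentiableAt (by simp))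
    exact this.differentiableAt.hasFDerivAt
  have hpull : pullM x Y =ᶠ[𝓝 z] fun z' ↦ h z' (c z') := by
    filter_upwards [eventually_symm_mem_source hz hyy] with z' hz'
    rw [pullM_apply hz'.1]
    exact congrArg (coframeAt x ((extChartAt (𝓡 n) x).symm z')) (frameAt_coframeAt hz'.2 _).symm
  have hpd : fderiv ℝ (pullM x Y) z = (h z).comp (fderiv ℝ c z) + (fderiv ℝ h z).flip (c z) := by
    rw [hpull.fderiv_eq]
    exact (hhd.clm_apply hcd).fderiv
  have h₁ : mvfderiv (𝓡 n) (components y Y) y v = fderiv ℝ c z (coframeAt x y v) :=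
    mvfderiv_eq_of_hasFDerivAt hz hcd v
  have h₂ : Γ.gauge y v = (g.symm : Gl n) *
      (Γ.coeff x z (coframeAt x y v) * g + fderiv ℝ h z (coframeAt x y v)) := by
    have hk : HasMFDerivAt (𝓡 n) 𝓘(ℝ, Vec n × Gl n)
        ((fun z' ↦ (z', h z')) ∘ extChartAt (𝓡 n) x) y
        (((ContinuousLinearMap.id ℝ (Vec n)).prod (fderiv ℝ h z)).comp (coframeAt x y)) :=
      HasMFDerivAt.comp y (g := fun z' ↦ (z', h z'))
        (by rw [e]; exact ((hasFDerivAt_id z).prodMk hhd).hasMFDerivAt) (mfderiv_extChartAt' hs)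
    have hky : ((fun z' ↦ (z', h z')) ∘ extChartAt (𝓡 n) x) y = (z, (g : Gl n)) := by
      change (extChartAt (𝓡 n) x y, h (extChartAt (𝓡 n) x y)) = _
      rw [e, hg]
    have hloc : localFrame n y =ᶠ[𝓝 y]
        ofCoord x ∘ ((fun z' ↦ (z', h z')) ∘ extChartAt (𝓡 n) x) := by
      filter_upwards [(isOpen_extChartAt_source (I := 𝓡 n) x).mem_nhds hs] with y' hy'
      have := toCoord_localFrame (y := y) hy'
      exact ((congrArg (ofCoord x) this).symm.trans (ofCoord_toCoord hy')).symm
    have := Γ.form_mfderiv (x := x) hk (by rw [hky]; exact hz) hloc v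
    rw [hky] at this
    exact this.trans (Γ.form_dofCoord hz g (coframeAt x y v) (fderiv ℝ h z (coframeAt x y v)))
  have h₃ : Γ.nabla Y y v = frameAt n y y (mvfderiv (𝓡 n) (components y Y) y v +
      Γ.gauge y v (components y Y y)) := rfl
  have h₄ : ∀ w : Vec n, frameAt n y y w = frameAt n x y (g w) := fun w ↦
    (frameAt_coframeAt hs _).symm
  have h₅ : components y Y y = c z := rfl
  rw [h₃, h₄, h₁, h₂, h₅, hpd, hpull.eq_of_nhds, hg]
  congr 1
  rw [map_add]
  change g _ + g (g.symm _) = _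
  rw [ContinuousLinearEquiv.apply_symm_apply]
  -- The inhomogeneous term dh(v)c of the gauge transformation is the one produced by the product
  -- rule for hc.
  change g (fderiv ℝ c z (coframeAt x y v)) + (Γ.coeff x z (coframeAt x y v) (g (c z)) +
    fderiv ℝ h z (coframeAt x y v) (c z)) = (g (fderiv ℝ c z (coframeAt x y v)) +
    fderiv ℝ h z (coframeAt x y v) (c z)) + Γ.coeff x z (coframeAt x y v) (g (c z))
  abel

end

section

/-! ### Curvature and torsion in coordinates -/

section Calculus

variable {E : Type*} [NormedAddCommGroup E] [NormedSpace ℝ E]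

/-- The torsion of the connection with coefficients `A`. -/
def torsionCoeff (A : E → E →L[ℝ] E →L[ℝ] E) (z v w : E) : E := A z v w - A z w v

/-- The curvature of the connection with coefficients `A`. -/
def curvCoeff (A : E → E →L[ℝ] E →L[ℝ] E) (z v w : E) : E →L[ℝ] E :=
  fderiv ℝ A z v w - fderiv ℝ A z w v + (A z v * A z w - A z w * A z v)

/-- The derivatives of X and Y are exactly the Lie bracket, so only the algebraic terms in A
survive. -/
lemma torsionCoeff_eq (A : E → E →L[ℝ] E →L[ℝ] E) (X Y : E → E) (z : E) :
    (fderiv ℝ Y z (X z) + A z (X z) (Y z)) - (fderiv ℝ X z (Y z) + A z (Y z) (X z)) -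
      VectorField.lieBracket ℝ X Y z = torsionCoeff A z (X z) (Y z) := by
  simp only [VectorField.lieBracket, torsionCoeff]
  abel

lemma fderiv_covariant {A : E → E →L[ℝ] E →L[ℝ] E} {Y Z : E → E} {z : E}
    (hA : DifferentiableAt ℝ A z) (hY : DifferentiableAt ℝ Y z) (hZ : ContDiffAt ℝ 2 Z z) (v : E) :
    fderiv ℝ (fun z ↦ fderiv ℝ Z z (Y z) + A z (Y z) (Z z)) z v =
      (fderiv ℝ (fderiv ℝ Z) z v (Y z) + fderiv ℝ Z z (fderiv ℝ Y z v)) +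
      (fderiv ℝ A z v (Y z) (Z z) + A z (fderiv ℝ Y z v) (Z z) + A z (Y z) (fderiv ℝ Z z v)) := by
  have hZ₁ := (hZ.differentiableAt (by simp)).hasFDerivAt
  have hZ₂ : HasFDerivAt (fderiv ℝ Z) (fderiv ℝ (fderiv ℝ Z) z) z :=
    ((hZ.fderiv_right (m := 1) (by norm_num)).differentiableAt (by simp)).hasFDerivAt
  have h := (hZ₂.clm_apply hY.hasFDerivAt).add
    ((hA.hasFDerivAt.clm_apply hY.hasFDerivAt).clm_apply hZ₁)
  rw [HasFDerivAt.fderiv (f := fun z ↦ fderiv ℝ Z z (Y z) + A z (Y z) (Z z)) h]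
  simp
  abel

lemma curvCoeff_eq {A : E → E →L[ℝ] E →L[ℝ] E} {X Y Z : E → E} {z : E}
    (hA : DifferentiableAt ℝ A z) (hX : DifferentiableAt ℝ X z) (hY : DifferentiableAt ℝ Y z)
    (hZ : ContDiffAt ℝ 2 Z z) :
    (fderiv ℝ (fun z ↦ fderiv ℝ Z z (Y z) + A z (Y z) (Z z)) z (X z) +
        A z (X z) (fderiv ℝ Z z (Y z) + A z (Y z) (Z z))) -
      (fderiv ℝ (fun z ↦ fderiv ℝ Z z (X z) + A z (X z) (Z z)) z (Y z) +
        A z (Y z) (fderiv ℝ Z z (X z) + A z (X z) (Z z))) -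
      (fderiv ℝ Z z (VectorField.lieBracket ℝ X Y z) +
        A z (VectorField.lieBracket ℝ X Y z) (Z z)) = curvCoeff A z (X z) (Y z) (Z z) := by
  -- Symmetry of second derivatives removes the second-order terms in Z; the bracket removes the
  -- derivatives of X and Y, and the mixed terms in A and dZ cancel in pairs.
  have hs : fderiv ℝ (fderiv ℝ Z) z (X z) (Y z) = fderiv ℝ (fderiv ℝ Z) z (Y z) (X z) :=
    hZ.isSymmSndFDerivAt (by rw [minSmoothness_of_isRCLikeNormedField]) _ _
  rw [fderiv_covariant hA hY hZ, fderiv_covariant hA hX hZ, hs]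
  simp only [VectorField.lieBracket, curvCoeff, map_add, map_sub, add_apply,
    sub_apply, mul_apply_eq_comp]
  abel

lemma contDiffAt_covariant {A : E → E →L[ℝ] E →L[ℝ] E} {Y Z : E → E} {z : E}
    (hA : ContDiffAt ℝ ∞ A z) (hY : ContDiffAt ℝ ∞ Y z) (hZ : ContDiffAt ℝ ∞ Z z) :
    ContDiffAt ℝ ∞ (fun z ↦ fderiv ℝ Z z (Y z) + A z (Y z) (Z z)) z :=
  ((hZ.fderiv_right (m := ∞) (by simp)).clm_apply hY).add ((hA.clm_apply hY).clm_apply hZ)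

end Calculus

variable {n : ℕ} {M : Type*} [TopologicalSpace M] [ChartedSpace (Vec n) M] [IsManifold (𝓡 n) ∞ M]

lemma LinearConnection.contDiffAt_coeff (Γ : LinearConnection n M) {x : M} {z : Vec n}
    (hz : z ∈ (extChartAt (𝓡 n) x).target) : ContDiffAt ℝ ∞ (Γ.coeff x) z :=
  (Γ.contDiffOn_coeff x).contDiffAt ((isOpen_extChartAt_target x).mem_nhds hz)

/-- The components of `∇_Y Z`. -/
def LinearConnection.covariant (Γ : LinearConnection n M) (x : M) (Y Z : Vec n → Vec n)
    (z : Vec n) : Vec n :=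
  fderiv ℝ Z z (Y z) + Γ.coeff x z (Y z) (Z z)

lemma LinearConnection.nabla_eq (Γ : LinearConnection n M) {x : M} {z : Vec n}
    (hz : z ∈ (extChartAt (𝓡 n) x).target) {Y Z : ∀ y : M, Tan (n := n) y}
    (hZ : ContMDiffAt (𝓡 n) (𝓡 n).tangent ∞ (fun y ↦ (⟨y, Z y⟩ : TangentBundle (𝓡 n) M))
      ((extChartAt (𝓡 n) x).symm z)) :
    Γ.nabla Z ((extChartAt (𝓡 n) x).symm z) (Y ((extChartAt (𝓡 n) x).symm z)) =
      frameAt n x ((extChartAt (𝓡 n) x).symm z) (Γ.covariant x (pullM x Y) (pullM x Z) z) := by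
  rw [Γ.nabla_apply hz hZ, ← pullM_apply hz, LinearConnection.covariant]

/-- The vector field `∇_Y Z` is smooth, with the expected components. -/
lemma LinearConnection.contMDiffAt_nabla (Γ : LinearConnection n M) {x : M} {z : Vec n}
    (hz : z ∈ (extChartAt (𝓡 n) x).target) {Y Z : ∀ y : M, Tan (n := n) y} {U : Set M}
    (hU : IsOpen U) (hzU : (extChartAt (𝓡 n) x).symm z ∈ U) (hY : SmoothFieldOn U Y)
    (hZ : SmoothFieldOn U Z) :
    ContMDiffAt (𝓡 n) (𝓡 n).tangent ∞
      (fun y ↦ (⟨y, Γ.nabla Z y (Y y)⟩ : TangentBundle (𝓡 n) M)) ((extChartAt (𝓡 n) x).symm z) ∧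
    pullM x (fun y ↦ Γ.nabla Z y (Y y)) =ᶠ[𝓝 z] Γ.covariant x (pullM x Y) (pullM x Z) := by
  have hs := (extChartAt (𝓡 n) x).map_target hz
  constructor
  · have h := contMDiffAt_pushM (f := Γ.covariant x (pullM x Y) (pullM x Z)) hs (by
      rw [(extChartAt (𝓡 n) x).right_inv hz]
      exact contDiffAt_covariant (Γ.contDiffAt_coeff hz)
        (contDiffAt_pullM hz (hY.contMDiffAt (hU.mem_nhds hzU)))
        (contDiffAt_pullM hz (hZ.contMDiffAt (hU.mem_nhds hzU))))
    refine h.congr_of_eventuallyEq ?_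
    filter_upwards [(isOpen_extChartAt_source (I := 𝓡 n) x).mem_nhds hs, hU.mem_nhds hzU]
      with y hy hyU
    have hyt := (extChartAt (𝓡 n) x).map_source hy
    have e := (extChartAt (𝓡 n) x).left_inv hy
    have := Γ.nabla_eq hyt (Y := Y) (Z := Z) (by rw [e]; exact hZ.contMDiffAt (hU.mem_nhds hyU))
    rw [e] at this
    rw [pushM_apply hy, this]
  · have hc := (contMDiffAt_extChartAt_symm' hz).continuousAt
    filter_upwards [(isOpen_extChartAt_target x).mem_nhds hz, hc (hU.mem_nhds hzU)] with z' hz' hU'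
    rw [pullM_apply hz', Γ.nabla_eq hz' (hZ.contMDiffAt (hU.mem_nhds hU')),
      coframeAt_frameAt ((extChartAt (𝓡 n) x).map_target hz')]

lemma LinearConnection.curvature_eq (Γ : LinearConnection n M) {x : M} {z : Vec n}
    (hz : z ∈ (extChartAt (𝓡 n) x).target) {X Y Z : ∀ y : M, Tan (n := n) y} {U : Set M}
    (hU : IsOpen U) (hzU : (extChartAt (𝓡 n) x).symm z ∈ U) (hX : SmoothFieldOn U X)
    (hY : SmoothFieldOn U Y) (hZ : SmoothFieldOn U Z) :
    Γ.curvature X Y Z ((extChartAt (𝓡 n) x).symm z) =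
      frameAt n x ((extChartAt (𝓡 n) x).symm z)
        (curvCoeff (Γ.coeff x) z (pullM x X z) (pullM x Y z) (pullM x Z z)) := by
  have hX' := hX.contMDiffAt (hU.mem_nhds hzU)
  have hY' := hY.contMDiffAt (hU.mem_nhds hzU)
  have hZ' := hZ.contMDiffAt (hU.mem_nhds hzU)
  obtain ⟨hYZ, eYZ⟩ := Γ.contMDiffAt_nabla hz hU hzU hY hZ
  obtain ⟨hXZ, eXZ⟩ := Γ.contMDiffAt_nabla hz hU hzU hX hZ
  have h₁ := Γ.nabla_eq hz (Y := X) hYZ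
  have h₂ := Γ.nabla_eq hz (Y := Y) hXZ
  have h₃ := Γ.nabla_eq hz (Y := VectorField.mlieBracket (𝓡 n) X Y) hZ'
  rw [LinearConnection.curvature, h₁, h₂, h₃, ← map_sub, ← map_sub]
  congr 1
  rw [LinearConnection.covariant, LinearConnection.covariant, LinearConnection.covariant,
    eYZ.fderiv_eq, eXZ.fderiv_eq, eYZ.eq_of_nhds, eXZ.eq_of_nhds, pullM_mlieBracket hz hX' hY']
  exact curvCoeff_eq ((Γ.contDiffAt_coeff hz).differentiableAt (by simp))
    ((contDiffAt_pullM hz hX').differentiableAt (by simp))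
    ((contDiffAt_pullM hz hY').differentiableAt (by simp))
    ((contDiffAt_pullM hz hZ').of_le (WithTop.coe_le_coe.2 (le_top : (2 : ℕ∞) ≤ ⊤)))

lemma LinearConnection.torsion_eq (Γ : LinearConnection n M) {x : M} {z : Vec n}
    (hz : z ∈ (extChartAt (𝓡 n) x).target) {X Y : ∀ y : M, Tan (n := n) y} {U : Set M}
    (hU : IsOpen U) (hzU : (extChartAt (𝓡 n) x).symm z ∈ U) (hX : SmoothFieldOn U X)
    (hY : SmoothFieldOn U Y) :
    Γ.nabla.torsion ((extChartAt (𝓡 n) x).symm z) (X ((extChartAt (𝓡 n) x).symm z))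
      (Y ((extChartAt (𝓡 n) x).symm z)) =
      frameAt n x ((extChartAt (𝓡 n) x).symm z)
        (torsionCoeff (Γ.coeff x) z (pullM x X z) (pullM x Y z)) := by
  have hX' := hX.contMDiffAt (hU.mem_nhds hzU)
  have hY' := hY.contMDiffAt (hU.mem_nhds hzU)
  rw [CovariantDerivative.torsion_apply _ (hX'.mdifferentiableAt (by simp))
    (hY'.mdifferentiableAt (by simp)), Γ.nabla_eq hz hX', Γ.nabla_eq hz hY',
    ← frameAt_pullM hz (VectorField.mlieBracket (𝓡 n) X Y), ← map_sub, ← map_sub,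
    pullM_mlieBracket hz hX' hY']
  congr 1
  exact torsionCoeff_eq (Γ.coeff x) _ _ z

/-- Flatness and torsion-freeness in coordinates. -/
theorem LinearConnection.isFlatAffine_iff (Γ : LinearConnection n M) :
    Γ.IsFlatAffine ↔ ∀ (x : M), ∀ z ∈ (extChartAt (𝓡 n) x).target, ∀ v w : Vec n,
      torsionCoeff (Γ.coeff x) z v w = 0 ∧ curvCoeff (Γ.coeff x) z v w = 0 := by
  constructor
  · rintro ⟨hc, ht⟩ x z hz v w
    have hs := (extChartAt (𝓡 n) x).map_target hz
    have hU := isOpen_extChartAt_source (I := 𝓡 n) x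
    have hinj : ∀ ξ : Vec n, frameAt n x ((extChartAt (𝓡 n) x).symm z) ξ = 0 → ξ = 0 :=
      fun ξ h ↦ (frameEquiv hs).injective (h.trans (map_zero (frameEquiv hs)).symm)
    have hsm : ∀ ξ : Vec n, SmoothFieldOn (extChartAt (𝓡 n) x).source (pushM x fun _ ↦ ξ) :=
      fun ξ ↦ smoothFieldOn_pushM x contDiff_const
    constructor
    · have h := Γ.torsion_eq hz hU hs (hsm v) (hsm w)
      rw [ht, pullM_pushM hz, pullM_pushM hz] at h
      exact hinj _ h.symm
    · ext1 ξ
      have h := Γ.curvature_eq hz hU hs (hsm v) (hsm w) (hsm ξ)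
      rw [hc _ _ _ _ hU (hsm v) (hsm w) (hsm ξ) _ hs, pullM_pushM hz, pullM_pushM hz,
        pullM_pushM hz] at h
      exact hinj _ h.symm
  · intro h
    constructor
    · intro U X Y Z hU hX hY hZ x hx
      have hx' := mem_extChartAt_target (I := 𝓡 n) x
      have e := (extChartAt (𝓡 n) x).left_inv (mem_extChartAt_source (I := 𝓡 n) x)
      have := Γ.curvature_eq hx' hU (by rwa [e]) hX hY hZ
      rw [(h x _ hx' _ _).2] at this
      rw [e] at this
      exact this.trans (map_zero _)
    · ext1 x
      have key : ∀ v w, Γ.nabla.torsion x v w = 0 := by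
        intro v w
        have hx' := mem_extChartAt_target (I := 𝓡 n) x
        have hxs := mem_extChartAt_source (I := 𝓡 n) x
        have e := (extChartAt (𝓡 n) x).left_inv hxs
        have hU := isOpen_extChartAt_source (I := 𝓡 n) x
        have hsm : ∀ ξ : Vec n, SmoothFieldOn (extChartAt (𝓡 n) x).source (pushM x fun _ ↦ ξ) :=
          fun ξ ↦ smoothFieldOn_pushM x contDiff_const
        have := Γ.torsion_eq hx' hU (by rwa [e]) (hsm (coframeAt x x v)) (hsm (coframeAt x x w))
        rw [(h x _ hx' _ _).1, e, pushM_apply hxs, pushM_apply hxs, frameAt_coframeAt hxs,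
          frameAt_coframeAt hxs] at this
        exact this.trans (map_zero _)
      ext1 v
      ext1 w
      exact key v w

end

section

/-! ### The structure equations -/

section Calculus

variable {E : Type*} [NormedAddCommGroup E] [NormedSpace ℝ E]

/-- The value at `p` of the vector field with `θ = ξ` and `ω = B`, for the connection with
coefficients `A`. -/
def etaField (A : E → E →L[ℝ] E →L[ℝ] E) (ξ : E) (B : E →L[ℝ] E) (p : E × (E →L[ℝ] E)) :
    E × (E →L[ℝ] E) :=
  (p.2 ξ, p.2 * B - A p.1 (p.2 ξ) * p.2)

lemma hasDerivAt_comp_of_differentiableAt {F : Type*} [NormedAddCommGroup F] [NormedSpace ℝ F]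
    {A : E → F} {c : ℝ → E} {v : E} {t : ℝ} (hc : HasDerivAt c v t)
    (hA : DifferentiableAt ℝ A (c t)) :
    HasDerivAt (fun t ↦ A (c t)) (fderiv ℝ A (c t) v) t :=
  hA.hasFDerivAt.comp_hasDerivAt t hc

lemma hasDerivAt_etaField {A : E → E →L[ℝ] E →L[ℝ] E} {ξ : E} {B : E →L[ℝ] E}
    {c : ℝ → E × (E →L[ℝ] E)} {w : E × (E →L[ℝ] E)} (hc : HasDerivAt c w 0)
    (hA : DifferentiableAt ℝ A (c 0).1) :
    HasDerivAt (fun t ↦ etaField A ξ B (c t))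
      (w.2 ξ, w.2 * B - ((fderiv ℝ A (c 0).1 w.1 ((c 0).2 ξ) + A (c 0).1 (w.2 ξ)) * (c 0).2 +
        A (c 0).1 ((c 0).2 ξ) * w.2)) 0 := by
  have h₁ : HasDerivAt (fun t ↦ (c t).1) w.1 0 := hc.fst
  have h₂ : HasDerivAt (fun t ↦ (c t).2) w.2 0 := hc.snd
  have h₃ : HasDerivAt (fun t ↦ (c t).2 ξ) (w.2 ξ) 0 := by
    simpa using h₂.clm_apply (hasDerivAt_const 0 ξ)
  have h₄ := hasDerivAt_comp_of_differentiableAt (A := A) h₁ hA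
  exact h₃.prodMk ((h₂.mul_const B).sub ((h₄.clm_apply h₃).mul h₂))

/-- The field Z need agree with `etaField` only along one curve, yet this fixes its derivative in
the direction of the velocity. For sections over Q nothing more is known. -/
lemma fderiv_eq_of_eventually_etaField {A : E → E →L[ℝ] E →L[ℝ] E} {ξ : E} {B : E →L[ℝ] E}
    {c : ℝ → E × (E →L[ℝ] E)} {w : E × (E →L[ℝ] E)} (hc : HasDerivAt c w 0)
    (hA : DifferentiableAt ℝ A (c 0).1) {Z : E × (E →L[ℝ] E) → E × (E →L[ℝ] E)}
    (hZ : DifferentiableAt ℝ Z (c 0)) (h : ∀ᶠ t in 𝓝 0, Z (c t) = etaField A ξ B (c t)) :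
    fderiv ℝ Z (c 0) w =
      (w.2 ξ, w.2 * B - ((fderiv ℝ A (c 0).1 w.1 ((c 0).2 ξ) + A (c 0).1 (w.2 ξ)) * (c 0).2 +
        A (c 0).1 ((c 0).2 ξ) * w.2)) :=
  (hZ.hasFDerivAt.comp_hasDerivAt 0 hc).unique
    ((hasDerivAt_etaField hc hA).congr_of_eventuallyEq h)

/-- The structure equations for two vector fields on which `θ` and `ω` are constant along
suitable curves. -/
lemma lieBracket_etaField {A : E → E →L[ℝ] E →L[ℝ] E} {p : E × (E →L[ℝ] E)}
    (hA : DifferentiableAt ℝ A p.1) {Z₁ Z₂ : E × (E →L[ℝ] E) → E × (E →L[ℝ] E)}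
    (hZ₁ : DifferentiableAt ℝ Z₁ p) (hZ₂ : DifferentiableAt ℝ Z₂ p) {ξ₁ ξ₂ : E}
    {B₁ B₂ : E →L[ℝ] E} {c₁ c₂ : ℝ → E × (E →L[ℝ] E)} (e₁ : c₁ 0 = p) (e₂ : c₂ 0 = p)
    (hc₁ : HasDerivAt c₁ (Z₁ p) 0) (hc₂ : HasDerivAt c₂ (Z₂ p) 0)
    (h₁ : ∀ᶠ t in 𝓝 0, Z₁ (c₂ t) = etaField A ξ₁ B₁ (c₂ t))
    (h₂ : ∀ᶠ t in 𝓝 0, Z₂ (c₁ t) = etaField A ξ₂ B₂ (c₁ t)) {ξ : E} {B : E →L[ℝ] E}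
    (hξ : p.2 ξ = p.2 (B₁ ξ₂ - B₂ ξ₁) - torsionCoeff A p.1 (p.2 ξ₁) (p.2 ξ₂))
    (hB : p.2 * B = p.2 * (B₁ * B₂ - B₂ * B₁) - curvCoeff A p.1 (p.2 ξ₁) (p.2 ξ₂) * p.2) :
    VectorField.lieBracket ℝ Z₁ Z₂ p = etaField A ξ B p := by
  have hv₁ : Z₁ p = etaField A ξ₁ B₁ p := by rw [← e₂]; exact h₁.self_of_nhds
  have hv₂ : Z₂ p = etaField A ξ₂ B₂ p := by rw [← e₁]; exact h₂.self_of_nhds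
  have d₂ := fderiv_eq_of_eventually_etaField hc₁ (by rwa [e₁]) (by rwa [e₁]) h₂
  have d₁ := fderiv_eq_of_eventually_etaField hc₂ (by rwa [e₂]) (by rwa [e₂]) h₁
  rw [e₁, hv₁] at d₂
  rw [e₂, hv₂] at d₁
  rw [VectorField.lieBracket, hv₁, hv₂, d₁, d₂]
  -- `hξ` and `hB` are the structure equations multiplied by the frame part `p.2`, so no inverse
  -- occurs and a ring identity remains.
  simp only [etaField, hξ, hB, torsionCoeff, curvCoeff]
  refine Prod.ext ?_ ?_
  · simp
    abel
  · simp only [Prod.snd_sub, map_sub, sub_apply, mul_apply_eq_comp]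
    noncomm_ring

lemma hasDerivAt_of_hasFDerivAt {c : ℝ → E} {L : ℝ →L[ℝ] E} {w : E} {t : ℝ}
    (h : HasFDerivAt c L t) (e : L 1 = w) : HasDerivAt c w t :=
  e ▸ h.hasDerivAt

lemma contDiffAt_etaField {A : E → E →L[ℝ] E →L[ℝ] E} {p : E × (E →L[ℝ] E)}
    (hA : ContDiffAt ℝ ∞ A p.1) (ξ : E) (B : E →L[ℝ] E) :
    ContDiffAt ℝ ∞ (etaField A ξ B) p := by
  have h₁ : ContDiffAt ℝ ∞ (fun p : E × (E →L[ℝ] E) ↦ p.2) p := contDiffAt_snd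
  have h₂ := h₁.clm_apply (contDiffAt_const (c := ξ))
  have h₃ : ContDiffAt ℝ ∞ (fun p : E × (E →L[ℝ] E) ↦ A p.1) p := hA.comp p contDiffAt_fst
  exact h₂.prodMk ((h₁.mul contDiffAt_const).sub ((h₃.clm_apply h₂).mul h₁))

end Calculus

variable {n : ℕ} {M : Type*} [TopologicalSpace M] [ChartedSpace (Vec n) M] [IsManifold (𝓡 n) ∞ M]

/-- For invertible a the equations a⁻¹v = ξ and a⁻¹(A(v)a + b) = B have exactly one solution (v, b):
`etaField` is the inverse of η at `p`. -/
lemma LinearConnection.eta_dofCoord_iff (Γ : LinearConnection n M) {x : M} {p : Vec n × Gl n}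
    (hp : p.1 ∈ (extChartAt (𝓡 n) x).target) (hp' : p.2.IsInvertible) (w : Vec n × Gl n)
    (ξ : Vec n) (B : Gl n) :
    Γ.eta (ofCoord x p) (dofCoord x p w) = ⟨ξ, B⟩ ↔ w = etaField (Γ.coeff x) ξ B p := by
  obtain ⟨z, a⟩ := p
  obtain ⟨v, b⟩ := w
  obtain ⟨g, rfl : (g : Gl n) = a⟩ := hp'
  have h₁ : (g : Gl n) * (g.symm : Gl n) = 1 := by ext1 w; simp
  have h₂ : (g.symm : Gl n) * (g : Gl n) = 1 := by ext1 w; simp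
  rw [Γ.eta_dofCoord hp, Aff.ext_iff, Prod.ext_iff]
  constructor
  · rintro ⟨e₁, e₂⟩
    replace e₁ : g.symm v = ξ := e₁
    replace e₂ : (g.symm : Gl n) * (Γ.coeff x z v * g + b) = B := e₂
    have e₁' : v = g ξ := by rw [← e₁]; simp
    refine ⟨e₁', ?_⟩
    have e₃ : (g : Gl n) * B = Γ.coeff x z v * g + b := by
      rw [← e₂, ← mul_assoc, h₁, one_mul]
    change b = g * B - Γ.coeff x z (g ξ) * g
    rw [e₃, e₁', add_sub_cancel_left]
  · rintro ⟨e₁, e₂⟩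
    replace e₁ : v = g ξ := e₁
    replace e₂ : b = g * B - Γ.coeff x z (g ξ) * g := e₂
    subst e₁ e₂
    refine ⟨g.symm_apply_apply ξ, ?_⟩
    change (g.symm : Gl n) * (Γ.coeff x z (g ξ) * g + (g * B - Γ.coeff x z (g ξ) * g)) = B
    rw [add_sub_cancel, ← mul_assoc, h₂, one_mul]

lemma IsTangentTo.exists_curve {Q : Set (FrameHom n M)} {u : FrameHom n M} {Z : TanP u}
    (h : IsTangentTo Q u Z) {x : M} (hu : u.proj ∈ (extChartAt (𝓡 n) x).source) :
    ∃ c : ℝ → Vec n × Gl n, c 0 = toCoord x u ∧ HasDerivAt c (dtoCoord x u Z) 0 ∧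
      (∀ᶠ t in 𝓝 0, (c t).1 ∈ (extChartAt (𝓡 n) x).target ∧ ofCoord x (c t) ∈ Q) ∧
      Tendsto (fun t ↦ ofCoord x (c t)) (𝓝 0) (𝓝 u) := by
  obtain ⟨c, hc, hcQ, e⟩ := h
  have e₀ : c 0 = u := congrArg TotalSpace.proj e
  subst e₀
  have e₁ : (mfderiv 𝓘(ℝ, ℝ) (FrameModel n) c 0 (1 : ℝ) : Vec n × Gl n) = Z :=
    congrArg (fun w : TangentBundle (FrameModel n) (FrameHom n M) ↦ (w.2 : Vec n × Gl n)) e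
  have hm := (hc.mdifferentiableAt (by simp)).hasMFDerivAt
  have hd := (HasMFDerivAt.comp (0 : ℝ) (hasMFDerivAt_toCoord hu) hm).hasFDerivAt
  have hev : ∀ᶠ t in 𝓝 (0 : ℝ), (c t).proj ∈ (extChartAt (𝓡 n) x).source :=
    hc.continuousAt ((isOpen_source_frameHom x).mem_nhds hu)
  refine ⟨fun t ↦ toCoord x (c t), rfl, ?_, ?_, ?_⟩
  · exact hasDerivAt_of_hasFDerivAt hd (congrArg (dtoCoord x (c 0)) e₁)
  · filter_upwards [hev, hcQ] with t ht htQ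
    rw [ofCoord_toCoord ht]
    exact ⟨(extChartAt (𝓡 n) x).map_source ht, htQ⟩
  · refine Tendsto.congr' ?_ hc.continuousAt
    filter_upwards [hev] with t ht
    exact (ofCoord_toCoord ht).symm

lemma isTangentTo_of_curve {Q : Set (FrameHom n M)} {x : M} {p w : Vec n × Gl n}
    (hp : p.1 ∈ (extChartAt (𝓡 n) x).target) {c : ℝ → Vec n × Gl n} (hc : ContDiffAt ℝ ∞ c 0)
    (h₀ : c 0 = p) (hd : HasDerivAt c w 0) (hQ : ∀ᶠ t in 𝓝 0, ofCoord x (c t) ∈ Q) :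
    IsTangentTo Q (ofCoord x p) (dofCoord x p w) := by
  subst h₀
  refine ⟨fun t ↦ ofCoord x (c t),
    ContMDiffAt.comp (0 : ℝ) (contMDiffAt_ofCoord hp) hc.contMDiffAt, hQ, ?_⟩
  have h := HasMFDerivAt.comp (0 : ℝ) (hasMFDerivAt_ofCoord hp) hd.hasFDerivAt.hasMFDerivAt
  have e : mfderiv 𝓘(ℝ, ℝ) (FrameModel n) (fun t ↦ ofCoord x (c t)) 0 (1 : ℝ) =
      dofCoord x (c 0) w := by
    refine (congrArg (fun L : ℝ →L[ℝ] Vec n × Gl n ↦ L (1 : ℝ)) h.mfderiv).trans ?_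
    exact congrArg (dofCoord x (c 0)) (one_smul ℝ w)
  exact congrArg (fun Z : TanP (ofCoord x (c 0)) ↦
    (⟨ofCoord x (c 0), Z⟩ : TangentBundle (FrameModel n) (FrameHom n M))) e

/-- If `η(Z)` is locally constant on `Q ∩ U`, then `Z` has constant coefficients along every curve
in `Q`. -/
lemma LinearConnection.eventually_pullP_eq (Γ : LinearConnection n M) {Q U : Set (FrameHom n M)}
    (hQ : Q ⊆ LM n M) (hU : IsOpen U) {x : M} {u : FrameHom n M} (hu : u ∈ Q ∩ U)
    {Z : ∀ u : FrameHom n M, TanP u} (hZ : LocConstOn (fun u ↦ Γ.eta u (Z u)) (Q ∩ U))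
    {c : ℝ → Vec n × Gl n}
    (hc : ∀ᶠ t in 𝓝 0, (c t).1 ∈ (extChartAt (𝓡 n) x).target ∧ ofCoord x (c t) ∈ Q)
    (hc' : Tendsto (fun t ↦ ofCoord x (c t)) (𝓝 0) (𝓝 u)) :
    ∀ᶠ t in 𝓝 0, pullP x Z (c t) =
      etaField (Γ.coeff x) (Γ.eta u (Z u)).trans (Γ.eta u (Z u)).lin (c t) := by
  have hcU : ∀ᶠ t in 𝓝 0, ofCoord x (c t) ∈ U := hc' (hU.mem_nhds hu.2)
  have hw : Tendsto (fun t ↦ ofCoord x (c t)) (𝓝 0) (𝓝[Q ∩ U] u) := by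
    refine tendsto_nhdsWithin_iff.2 ⟨hc', ?_⟩
    filter_upwards [hc, hcU] with t ht htU using ⟨ht.2, htU⟩
  filter_upwards [hc, hw.eventually (hZ u hu)] with t ht hte
  rw [← Γ.eta_dofCoord_iff ht.1 ((ofCoord_mem_LM_iff ht.1).1 (hQ ht.2)), dofCoord_pullP ht.1]
  exact hte

end

section

attribute [local instance] LieRing.ofAssociativeRing

/-! ### Integral curves -/

section ODE

variable {V : Type*} [NormedAddCommGroup V] [NormedSpace ℝ V]

/-- Bootstrapping: if α is of class Cᵏ, so is α' = G ∘ α. This is needed because tangency to Q asks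
for a smooth curve, while the existence theorem yields a differentiable one. -/
lemma contDiffOn_of_hasDerivAt {G : V → V} {W : Set V} (hG : ContDiffOn ℝ ∞ G W) {α : ℝ → V}
    {I : Set ℝ} (hI : IsOpen I) (hα : ∀ t ∈ I, HasDerivAt α (G (α t)) t) (hW : MapsTo α I W) :
    ContDiffOn ℝ ∞ α I := by
  rw [contDiffOn_infty]
  intro k
  induction k with
  | zero =>
    exact contDiffOn_zero.2 fun t ht ↦ (hα t ht).continuousAt.continuousWithinAt
  | succ k ih =>
    push_cast
    rw [contDiffOn_succ_iff_deriv_of_isOpen hI]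
    refine ⟨fun t ht ↦ (hα t ht).differentiableAt.differentiableWithinAt, by simp, ?_⟩
    exact ((hG.of_le (by exact_mod_cast le_top)).comp ih hW).congr fun t ht ↦ (hα t ht).deriv

lemma exists_contDiffOn_integralCurve [CompleteSpace V] {G : V → V} {W : Set V} (hWo : IsOpen W)
    (hG : ContDiffOn ℝ ∞ G W) {p : V} (hp : p ∈ W) :
    ∃ (α : ℝ → V) (ε : ℝ), 0 < ε ∧ α 0 = p ∧ ContDiffOn ℝ ∞ α (Ioo (-ε) ε) ∧
      ∀ t ∈ Ioo (-ε) ε, HasDerivAt α (G (α t)) t ∧ α t ∈ W := by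
  have hG' : ContDiffAt ℝ 1 G p :=
    (hG.contDiffAt (hWo.mem_nhds hp)).of_le (WithTop.coe_le_coe.2 (le_top : (1 : ℕ∞) ≤ ⊤))
  obtain ⟨α, h₀, ε, hε, hα⟩ :=
    hG'.exists_forall_mem_closedBall_exists_eq_forall_mem_Ioo_hasDerivAt₀ 0
  have hcont : ContinuousAt α 0 := (hα 0 ⟨by linarith, by linarith⟩).continuousAt
  have hev : ∀ᶠ t in 𝓝 (0 : ℝ), α t ∈ W := hcont (hWo.mem_nhds (by rwa [h₀]))
  obtain ⟨δ, hδ, hδW⟩ := Metric.eventually_nhds_iff.1 hev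
  have key : ∀ t ∈ Ioo (-min ε δ) (min ε δ), HasDerivAt α (G (α t)) t ∧ α t ∈ W := by
    intro t ht
    have h₁ := min_le_left ε δ
    have h₂ := min_le_right ε δ
    refine ⟨hα t ⟨by linarith [ht.1], by linarith [ht.2]⟩, hδW ?_⟩
    rw [Real.dist_eq, sub_zero, abs_lt]
    exact ⟨by linarith [ht.1], by linarith [ht.2]⟩
  exact ⟨α, min ε δ, lt_min hε hδ, h₀, contDiffOn_of_hasDerivAt hG isOpen_Ioo
    (fun t ht ↦ (key t ht).1) fun t ht ↦ (key t ht).2, key⟩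

lemma torsionCoeff_zero_left (A : V → V →L[ℝ] V →L[ℝ] V) (z w : V) :
    torsionCoeff A z 0 w = 0 := by
  simp [torsionCoeff]

set_option synthInstance.maxHeartbeats 200000 in
lemma curvCoeff_zero_left (A : V → V →L[ℝ] V →L[ℝ] V) (z w : V) :
    curvCoeff A z 0 w = 0 := by
  simp [curvCoeff]

lemma eq_zero_of_symm_mul_neg_mul (g : V ≃L[ℝ] V) (R : V →L[ℝ] V)
    (h : (g.symm : V →L[ℝ] V) * -(R * (g : V →L[ℝ] V)) = 0) : R = 0 := by
  ext1 v
  have := congrArg (fun T : V →L[ℝ] V ↦ g (T (g.symm v))) h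
  simpa using this

end ODE

variable {n : ℕ} {M : Type*} [TopologicalSpace M] [ChartedSpace (Vec n) M] [IsManifold (𝓡 n) ∞ M]

/-! ### Flatness in terms of `η` -/

lemma exists_eq_ofCoord (u : FrameHom n M) :
    ∃ (x : M) (p : Vec n × Gl n), p.1 ∈ (extChartAt (𝓡 n) x).target ∧ u = ofCoord x p :=
  ⟨u.proj, toCoord u.proj u, (extChartAt (𝓡 n) u.proj).map_source (mem_extChartAt_source _),
    (ofCoord_toCoord (mem_extChartAt_source _)).symm⟩

/-- The structure equations on a reduction of the frame bundle. -/
lemma LinearConnection.eta_mlieBracket (Γ : LinearConnection n M) {Q U : Set (FrameHom n M)}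
    (hQ : Q ⊆ LM n M) (hU : IsOpen U) {x : M} {p : Vec n × Gl n}
    (hp : p.1 ∈ (extChartAt (𝓡 n) x).target) (hu : ofCoord x p ∈ Q ∩ U)
    {Z₁ Z₂ : ∀ u : FrameHom n M, TanP u} (hZ₁ : IsSectionOn Q U Z₁) (hZ₂ : IsSectionOn Q U Z₂)
    (h₁ : LocConstOn (fun u ↦ Γ.eta u (Z₁ u)) (Q ∩ U))
    (h₂ : LocConstOn (fun u ↦ Γ.eta u (Z₂ u)) (Q ∩ U)) {ξ₁ ξ₂ ξ : Vec n} {B₁ B₂ B : Gl n}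
    (e₁ : Γ.eta (ofCoord x p) (Z₁ (ofCoord x p)) = ⟨ξ₁, B₁⟩)
    (e₂ : Γ.eta (ofCoord x p) (Z₂ (ofCoord x p)) = ⟨ξ₂, B₂⟩)
    (hξ : p.2 ξ = p.2 (B₁ ξ₂ - B₂ ξ₁) - torsionCoeff (Γ.coeff x) p.1 (p.2 ξ₁) (p.2 ξ₂))
    (hB : p.2 * B = p.2 * (B₁ * B₂ - B₂ * B₁) -
      curvCoeff (Γ.coeff x) p.1 (p.2 ξ₁) (p.2 ξ₂) * p.2) :
    Γ.eta (ofCoord x p) (VectorField.mlieBracket (FrameModel n) Z₁ Z₂ (ofCoord x p)) =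
      ⟨ξ, B⟩ := by
  have hs : (ofCoord x p).proj ∈ (extChartAt (𝓡 n) x).source := (extChartAt (𝓡 n) x).map_target hp
  obtain ⟨c₁, hc₁, hd₁, hQ₁, ht₁⟩ := (hZ₁.tangent _ hu).exists_curve hs
  obtain ⟨c₂, hc₂, hd₂, hQ₂, ht₂⟩ := (hZ₂.tangent _ hu).exists_curve hs
  rw [toCoord_ofCoord hp] at hc₁ hc₂
  rw [← pullP_apply hp] at hd₁ hd₂
  -- The roles are crossed: the bracket contains the derivative of `Z₁` in the direction of `Z₂`,
  -- hence along `c₂`, and conversely.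
  have k₁ := Γ.eventually_pullP_eq hQ hU hu h₁ hQ₂ ht₂
  have k₂ := Γ.eventually_pullP_eq hQ hU hu h₂ hQ₁ ht₁
  rw [e₁] at k₁
  rw [e₂] at k₂
  rw [← dofCoord_pullP hp (VectorField.mlieBracket (FrameModel n) Z₁ Z₂), Γ.eta_dofCoord_iff hp ((ofCoord_mem_LM_iff hp).1 (hQ hu.1)),
    pullP_mlieBracket hU hZ₁.smooth hZ₂.smooth hp hu.2]
  exact lieBracket_etaField ((Γ.contDiffAt_coeff hp).differentiableAt (by simp))
    ((contDiffAt_pullP hU hZ₁.smooth hp hu.2).differentiableAt (by simp))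
    ((contDiffAt_pullP hU hZ₂.smooth hp hu.2).differentiableAt (by simp))
    hc₁ hc₂ hd₁ hd₂ k₁ k₂ hξ hB

/-- Without torsion and curvature the structure equations are the homomorphism property. Conversely,
two fields with η = (ξ, 0) and (ζ, 0) have commuting values, so the homomorphism property makes η of
their bracket zero, while the structure equations make it minus torsion and curvature, read in the
frame. -/
theorem LinearConnection.isFlatAffine_iff_etaIsHom (Γ : LinearConnection n M)
    {Q : Set (FrameHom n M)} {𝔤 : LieSubalgebra ℝ (Gl n)} (hQ : Q ⊆ LM n M)
    (hvalues : ∀ u ∈ Q, ∀ Z : TanP u, IsTangentTo Q u Z → Γ.form u Z ∈ 𝔤)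
    (hhor : ∀ (x : M) (p : Vec n × Gl n) (ξ : Vec n), p.1 ∈ (extChartAt (𝓡 n) x).target →
      ofCoord x p ∈ Q → IsTangentTo Q (ofCoord x p)
        (dofCoord x p (etaField (Γ.coeff x) ξ 0 p)))
    (hsurj : ∀ (y : M) (v : Vec n), v ≠ 0 → ∃ u ∈ Q, u.proj = y) :
    Γ.IsFlatAffine ↔ Γ.EtaIsHom Q 𝔤 := by
  rw [Γ.isFlatAffine_iff]
  constructor
  · intro h
    refine ⟨hvalues, fun U Z₁ Z₂ hU _ hZ₁ hZ₂ h₁ h₂ u hu ↦ ?_⟩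
    obtain ⟨x, p, hp, rfl⟩ := exists_eq_ofCoord u
    refine Γ.eta_mlieBracket hQ hU hp hu hZ₁ hZ₂ h₁ h₂ rfl rfl ?_ ?_
    · rw [(h x _ hp _ _).1, sub_zero]
      rfl
    · rw [(h x _ hp _ _).2, zero_mul, sub_zero]
      rfl
  · intro h x z hz v w
    -- A nonzero vector rules out n = 0. In that dimension a volume form is a nonzero constant on
    -- each fibre, possibly different from 1, and Q may miss the fibre.
    by_cases hv : v = 0
    · rw [hv]
      exact ⟨torsionCoeff_zero_left _ z w, curvCoeff_zero_left _ z w⟩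
    obtain ⟨u, huQ, huz⟩ := hsurj ((extChartAt (𝓡 n) x).symm z) v hv
    have hus : u.proj ∈ (extChartAt (𝓡 n) x).source := by
      rw [huz]; exact (extChartAt (𝓡 n) x).map_target hz
    obtain ⟨a, ha⟩ : ∃ a, toCoord x u = (z, a) := by
      refine ⟨(toCoord x u).2, Prod.ext ?_ rfl⟩
      change extChartAt (𝓡 n) x u.proj = z
      rw [huz, (extChartAt (𝓡 n) x).right_inv hz]
    have hua : ofCoord x (z, a) = u := by rw [← ha, ofCoord_toCoord hus]
    subst hua
    have hz' : (z, a).1 ∈ (extChartAt (𝓡 n) x).target := hz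
    obtain ⟨g, rfl : (g : Gl n) = a⟩ := (ofCoord_mem_LM_iff hz').1 (hQ huQ)
    -- the standard horizontal vector fields
    let B : Vec n → ∀ u : FrameHom n M, TanP u := fun ξ ↦ pushP x (etaField (Γ.coeff x) ξ 0)
    let U : Set (FrameHom n M) := {u | u.proj ∈ (extChartAt (𝓡 n) x).source} ∩ LM n M
    have hU : IsOpen U := (isOpen_source_frameHom x).inter isOpen_LM
    have hUq : ∀ u ∈ U, ∃ q : Vec n × Gl n, q.1 ∈ (extChartAt (𝓡 n) x).target ∧
        ofCoord x q = u := fun u hu ↦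
      ⟨toCoord x u, (extChartAt (𝓡 n) x).map_source hu.1, ofCoord_toCoord hu.1⟩
    have hBeta : ∀ ξ, ∀ u ∈ U, Γ.eta u (B ξ u) = ⟨ξ, 0⟩ := by
      intro ξ u hu
      obtain ⟨q, hq, rfl⟩ := hUq u hu
      have e : B ξ (ofCoord x q) = _ := pushP_ofCoord hq _
      rw [e, Γ.eta_dofCoord_iff hq ((ofCoord_mem_LM_iff hq).1 hu.2)]
    have hBsec : ∀ ξ, IsSectionOn Q U (B ξ) := by
      intro ξ
      constructor
      · refine (smoothFieldPOn_pushP x (isOpen_target_prod x) (fun q hq ↦ ?_)).mono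
          fun u hu ↦ ⟨hu.1, (extChartAt (𝓡 n) x).map_source hu.1, mem_univ _⟩
        exact (contDiffAt_etaField (Γ.contDiffAt_coeff hq.1) ξ 0).contDiffWithinAt
      · rintro u ⟨huQ, hu⟩
        obtain ⟨q, hq, rfl⟩ := hUq u hu
        have e : B ξ (ofCoord x q) = _ := pushP_ofCoord hq _
        rw [e]
        exact hhor x q ξ hq huQ
    have hBconst : ∀ ξ, LocConstOn (fun u ↦ Γ.eta u (B ξ u)) (Q ∩ U) := by
      intro ξ u hu
      filter_upwards [self_mem_nhdsWithin] with u' hu'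
      rw [hBeta ξ u hu.2, hBeta ξ u' hu'.2]
    have huU : ofCoord x (z, (g : Gl n)) ∈ U := ⟨hus, hQ huQ⟩
    -- The vectors g⁻¹v and g⁻¹w are chosen so that the frame g carries them to the prescribed v and
    -- w.
    have hmap := h.map_lie U (B (g.symm v)) (B (g.symm w)) hU inter_subset_right (hBsec _)
      (hBsec _) (hBconst _) (hBconst _) _ ⟨huQ, huU⟩
    have hg : (g : Gl n) * (g.symm : Gl n) = 1 := by ext1 w; simp
    have hg' : (g.symm : Gl n) * (g : Gl n) = 1 := by ext1 w; simp
    have hgv : ∀ v, (g : Gl n) (g.symm v) = v := g.apply_symm_apply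
    have hstr := Γ.eta_mlieBracket hQ hU hz' ⟨huQ, huU⟩ (hBsec _) (hBsec _) (hBconst _)
      (hBconst _) (hBeta (g.symm v) _ huU) (hBeta (g.symm w) _ huU)
      (ξ := g.symm (-torsionCoeff (Γ.coeff x) z v w))
      (B := (g.symm : Gl n) * -(curvCoeff (Γ.coeff x) z v w * (g : Gl n)))
      (by
        rw [hgv, hgv, hgv]
        change _ = (g : Gl n) ((0 : Gl n) _ - (0 : Gl n) _) - _
        simp)
      (by
        change (g : Gl n) * _ = (g : Gl n) * _ -
          curvCoeff (Γ.coeff x) z ((g : Gl n) _) ((g : Gl n) _) * (g : Gl n)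
        rw [hgv, hgv, ← mul_assoc, hg, one_mul]
        simp)
    rw [hstr, hBeta _ _ huU, hBeta _ _ huU, Aff.ext_iff] at hmap
    obtain ⟨m₁, m₂⟩ := hmap
    constructor
    · replace m₁ : g.symm (-torsionCoeff (Γ.coeff x) z v w) = (0 : Gl n) _ - (0 : Gl n) _ := m₁
      simpa using m₁
    · refine eq_zero_of_symm_mul_neg_mul g _ (m₂.trans ?_)
      change (0 : Gl n) * 0 - 0 * 0 = 0
      simp

end

section

attribute [local instance] LieRing.ofAssociativeRing

variable {n : ℕ} {M : Type*} [TopologicalSpace M] [ChartedSpace (Vec n) M] [IsManifold (𝓡 n) ∞ M]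

/-! ### Reductions defined by functions on the frame bundle -/

/-- The relation aC = A(v)a + b expresses ω(v, b) = C without inverting a. Here it says that the
horizontal field has ω = 0. -/
lemma mul_zero_eq_of_etaField {V : Type*} [NormedAddCommGroup V] [NormedSpace ℝ V]
    (A : V → V →L[ℝ] V →L[ℝ] V) (ξ : V) (p : V × (V →L[ℝ] V)) :
    p.2 * 0 = A p.1 (etaField A ξ 0 p).1 * p.2 + (etaField A ξ 0 p).2 := by
  ext1 v
  simp [etaField]

lemma eq_of_hasDerivAt_zero {f : ℝ → ℝ} {ε : ℝ} (hε : 0 < ε)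
    (h : ∀ t ∈ Ioo (-ε) ε, HasDerivAt f 0 t) : ∀ t ∈ Ioo (-ε) ε, f t = f 0 := fun _ ht ↦
  isOpen_Ioo.is_const_of_deriv_eq_zero isPreconnected_Ioo
    (fun s hs ↦ (h s hs).differentiableAt.differentiableWithinAt) (fun s hs ↦ (h s hs).deriv) ht
    ⟨by linarith, hε⟩

/-- Suppose that `Q` is the set of frames on which the functions `F i` have prescribed values
`w i`, and that the derivative of `F i` along a curve in the frame bundle depends on the value of
the connection form on its velocity only. -/
theorem LinearConnection.isFlatAffine_iff_etaIsHom_of_hasDerivAt (Γ : LinearConnection n M)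
    {ι : Type*} (F : ι → FrameHom n M → ℝ) (w : ι → ℝ) (D : ι → FrameHom n M → Gl n → ℝ)
    {𝔤 : LieSubalgebra ℝ (Gl n)} (hD : ∀ i u, D i u 0 = 0)
    (hF : ∀ (i : ι) (x : M) (c : ℝ → Vec n × Gl n) (c' : Vec n × Gl n) (t : ℝ) (C : Gl n),
      HasDerivAt c c' t → (c t).1 ∈ (extChartAt (𝓡 n) x).target → ofCoord x (c t) ∈ LM n M →
      (c t).2 * C = Γ.coeff x (c t).1 c'.1 * (c t).2 + c'.2 →
      HasDerivAt (fun s ↦ F i (ofCoord x (c s))) (D i (ofCoord x (c t)) C) t)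
    (h𝔤 : ∀ u ∈ LM n M, (∀ i, F i u = w i) → ∀ C, (∀ i, D i u C = 0) → C ∈ 𝔤)
    (hsurj : ∀ (y : M) (v : Vec n), v ≠ 0 → ∃ u ∈ LM n M, (∀ i, F i u = w i) ∧ u.proj = y) :
    Γ.IsFlatAffine ↔ Γ.EtaIsHom {u | u ∈ LM n M ∧ ∀ i, F i u = w i} 𝔤 := by
  refine Γ.isFlatAffine_iff_etaIsHom (fun u hu ↦ hu.1) ?_ ?_ ?_
  · intro u hu Z hZ
    obtain ⟨x, p, hp, rfl⟩ := exists_eq_ofCoord u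
    have hs : (ofCoord x p).proj ∈ (extChartAt (𝓡 n) x).source :=
      (extChartAt (𝓡 n) x).map_target hp
    obtain ⟨c, hc, hd, hcQ, -⟩ := hZ.exists_curve hs
    rw [toCoord_ofCoord hp] at hc
    subst hc
    obtain ⟨g, hg : (g : Gl n) = (c 0).2⟩ := (ofCoord_mem_LM_iff hp).1 hu.1
    refine h𝔤 _ hu.1 hu.2 _ fun i ↦ ?_
    have hform : Γ.form (ofCoord x (c 0)) Z = (g.symm : Gl n) *
        (Γ.coeff x (c 0).1 (dtoCoord x (ofCoord x (c 0)) Z).1 * (g : Gl n) +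
          (dtoCoord x (ofCoord x (c 0)) Z).2) := by
      have e := Γ.form_dofCoord hp g (dtoCoord x (ofCoord x (c 0)) Z).1
        (dtoCoord x (ofCoord x (c 0)) Z).2
      rw [hg] at e ⊢
      exact (congrArg _ (dofCoord_dtoCoord hp Z).symm).trans e
    -- Along a curve in Q the function `F i` is constant, so its derivative, which is `D i` at ω(Z),
    -- is zero.
    refine (hF i x c _ 0 (Γ.form (ofCoord x (c 0)) Z) hd hp hu.1 ?_).unique ?_
    · rw [hform, ← hg]
      ext1 v
      exact g.apply_symm_apply _
    · refine (hasDerivAt_const (0 : ℝ) (w i)).congr_of_eventuallyEq ?_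
      filter_upwards [hcQ] with t ht
      exact ht.2.2 i
  · intro x p ξ hp hu
    have hW : IsOpen {p : Vec n × Gl n | p.1 ∈ (extChartAt (𝓡 n) x).target ∧ p.2.IsInvertible} :=
      ((isOpen_extChartAt_target x).preimage continuous_fst).inter
        (ContinuousLinearEquiv.isOpen.preimage continuous_snd)
    have hG : ContDiffOn ℝ ∞ (etaField (Γ.coeff x) ξ 0)
        {p : Vec n × Gl n | p.1 ∈ (extChartAt (𝓡 n) x).target ∧ p.2.IsInvertible} :=
      fun q hq ↦ (contDiffAt_etaField (Γ.contDiffAt_coeff hq.1) ξ 0).contDiffWithinAt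
    -- The curve witnessing tangency is the integral curve of the horizontal field. There ω = 0, so
    -- each `F i` has derivative `D i u 0 = 0` and the curve stays in Q.
    obtain ⟨α, ε, hε, h₀, hα, hd⟩ := exists_contDiffOn_integralCurve hW hG
      (p := p) ⟨hp, (ofCoord_mem_LM_iff hp).1 hu.1⟩
    have hI : Ioo (-ε) ε ∈ 𝓝 (0 : ℝ) := Ioo_mem_nhds (by linarith) hε
    have hd₀ := (hd 0 (mem_of_mem_nhds hI)).1
    rw [h₀] at hd₀
    refine isTangentTo_of_curve hp (hα.contDiffAt hI) h₀ hd₀ ?_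
    filter_upwards [hI] with t ht
    have hLM : ∀ s ∈ Ioo (-ε) ε, ofCoord x (α s) ∈ LM n M := fun s hs ↦
      (ofCoord_mem_LM_iff (hd s hs).2.1).2 (hd s hs).2.2
    refine ⟨hLM t ht, fun i ↦ ?_⟩
    have h := eq_of_hasDerivAt_zero hε (f := fun s ↦ F i (ofCoord x (α s))) (fun s hs ↦ ?_) t ht
    · rw [← hu.2 i, ← h₀]
      exact h
    · have := hF i x α _ s 0 (hd s hs).1 (hd s hs).2.1 (hLM s hs) (mul_zero_eq_of_etaField _ ξ _)
      rwa [hD] at this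
  · intro y v hv
    obtain ⟨u, hu, hF, hy⟩ := hsurj y v hv
    exact ⟨u, ⟨hu, hF⟩, hy⟩

end

section

attribute [local instance] LieRing.ofAssociativeRing

variable {n : ℕ} {M : Type*} [TopologicalSpace M] [ChartedSpace (Vec n) M] [IsManifold (𝓡 n) ∞ M]

/-! ### Parallel bilinear forms -/

lemma hasDerivAt_vec_apply {c : ℝ → Vec n} {c' : Vec n} {t : ℝ} (h : HasDerivAt c c' t)
    (i : Fin n) : HasDerivAt (fun s ↦ c s i) (c' i) t :=
  (EuclideanSpace.proj (𝕜 := ℝ) i : Vec n →L[ℝ] ℝ).hasFDerivAt.comp_hasDerivAt t h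

lemma bilin_eq_sum (β : LinearMap.BilinForm ℝ (Vec n)) (v w : Vec n) :
    β v w = ∑ i, ∑ j, v i * w j *
      β (EuclideanSpace.basisFun (Fin n) ℝ i) (EuclideanSpace.basisFun (Fin n) ℝ j) := by
  conv_lhs => rw [← (EuclideanSpace.basisFun (Fin n) ℝ).sum_repr v,
    ← (EuclideanSpace.basisFun (Fin n) ℝ).sum_repr w]
  simp only [map_sum, map_smul, LinearMap.sum_apply, LinearMap.smul_apply, smul_eq_mul,
    EuclideanSpace.basisFun_repr, Finset.mul_sum]
  rw [Finset.sum_comm]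
  exact Finset.sum_congr rfl fun i _ ↦ Finset.sum_congr rfl fun j _ ↦ by ring

/-- The forms are purely algebraic and their space carries no norm here, so the product rule is
applied to the expansion in the standard basis. -/
lemma hasDerivAt_bilin {β : ℝ → LinearMap.BilinForm ℝ (Vec n)} {β' : LinearMap.BilinForm ℝ (Vec n)}
    {c d : ℝ → Vec n} {c' d' : Vec n} {t : ℝ}
    (hβ : ∀ v w, HasDerivAt (fun s ↦ β s v w) (β' v w) t) (hc : HasDerivAt c c' t)
    (hd : HasDerivAt d d' t) :
    HasDerivAt (fun s ↦ β s (c s) (d s)) (β' (c t) (d t) + β t c' (d t) + β t (c t) d') t := by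
  have h := HasDerivAt.fun_sum (u := Finset.univ) fun i _ ↦ HasDerivAt.fun_sum (u := Finset.univ)
    fun j _ ↦ ((hasDerivAt_vec_apply hc i).fun_mul (hasDerivAt_vec_apply hd j)).fun_mul
      (hβ (EuclideanSpace.basisFun (Fin n) ℝ i) (EuclideanSpace.basisFun (Fin n) ℝ j))
  have e : (fun s ↦ β s (c s) (d s)) = fun s ↦ ∑ i, ∑ j, c s i * d s j *
      β s (EuclideanSpace.basisFun (Fin n) ℝ i) (EuclideanSpace.basisFun (Fin n) ℝ j) :=
    funext fun s ↦ bilin_eq_sum _ _ _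
  rw [e]
  refine h.congr_deriv ?_
  rw [bilin_eq_sum β', bilin_eq_sum (β t), bilin_eq_sum (β t)]
  simp only [← Finset.sum_add_distrib]
  refine Finset.sum_congr rfl fun i _ ↦ Finset.sum_congr rfl fun j _ ↦ ?_
  ring

section Bilin

variable {β : ∀ y : M, LinearMap.BilinForm ℝ (Tan (n := n) y)}

/-- The components of a field of bilinear forms in the chart around `x`. -/
def bilinCoord (β : ∀ y : M, LinearMap.BilinForm ℝ (Tan (n := n) y)) (x : M) (z : Vec n) :
    LinearMap.BilinForm ℝ (Vec n) :=
  (β ((extChartAt (𝓡 n) x).symm z)).compl₁₂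
    (frameAt n x ((extChartAt (𝓡 n) x).symm z) : Vec n →ₗ[ℝ] _)
    (frameAt n x ((extChartAt (𝓡 n) x).symm z) : Vec n →ₗ[ℝ] _)

lemma contDiffAt_comp_extChartAt_symm {f : M → ℝ} {x : M} {z : Vec n}
    (hz : z ∈ (extChartAt (𝓡 n) x).target)
    (hf : ContMDiffOn (𝓡 n) 𝓘(ℝ, ℝ) ∞ f (extChartAt (𝓡 n) x).source) :
    ContDiffAt ℝ ∞ (fun z ↦ f ((extChartAt (𝓡 n) x).symm z)) z :=
  ((hf.contMDiffAt ((isOpen_extChartAt_source x).mem_nhds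
    ((extChartAt (𝓡 n) x).map_target hz))).comp z (contMDiffAt_extChartAt_symm' hz)).contDiffAt

lemma LinearConnection.nabla_pushM_const (Γ : LinearConnection n M) {x : M} {z : Vec n}
    (hz : z ∈ (extChartAt (𝓡 n) x).target) (ξ v : Vec n) :
    Γ.nabla (pushM x fun _ ↦ ξ) ((extChartAt (𝓡 n) x).symm z)
      (frameAt n x ((extChartAt (𝓡 n) x).symm z) v) =
      frameAt n x ((extChartAt (𝓡 n) x).symm z) (Γ.coeff x z v ξ) := by
  have hs := (extChartAt (𝓡 n) x).map_target hz
  have h : pullM x (pushM x fun _ ↦ ξ) =ᶠ[𝓝 z] fun _ ↦ ξ := by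
    filter_upwards [(isOpen_extChartAt_target x).mem_nhds hz] with z' hz'
    exact pullM_pushM hz' _
  rw [Γ.nabla_apply hz (contMDiffAt_pushM hs contDiffAt_const), coframeAt_frameAt hs, h.fderiv_eq,
    h.eq_of_nhds]
  simp

variable (hsm : ∀ (U : Set M) (X Y : ∀ x : M, Tan (n := n) x), IsOpen U → SmoothFieldOn U X →
    SmoothFieldOn U Y → ContMDiffOn (𝓡 n) 𝓘(ℝ, ℝ) ∞ (fun x ↦ β x (X x) (Y x)) U)

-- Parallelism is applied to the fields with constant components ξ and ζ in the chart, whose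
-- covariant derivatives are A(v)ξ and A(v)ζ.
include hsm in
lemma LinearConnection.hasFDerivAt_bilinCoord (Γ : LinearConnection n M)
    (hΓ : ∀ (U : Set M) (Y Z : ∀ x : M, Tan (n := n) x), IsOpen U → SmoothFieldOn U Y →
      SmoothFieldOn U Z → ∀ x ∈ U, ∀ v : Tan (n := n) x,
        mvfderiv (𝓡 n) (fun y ↦ β y (Y y) (Z y)) x v =
          β x (Γ.nabla Y x v) (Z x) + β x (Y x) (Γ.nabla Z x v))
    {x : M} {z : Vec n} (hz : z ∈ (extChartAt (𝓡 n) x).target) (ξ ζ : Vec n) :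
    ∃ L : Vec n →L[ℝ] ℝ, HasFDerivAt (fun z ↦ bilinCoord β x z ξ ζ) L z ∧ ∀ v, L v =
      bilinCoord β x z (Γ.coeff x z v ξ) ζ + bilinCoord β x z ξ (Γ.coeff x z v ζ) := by
  have hs := (extChartAt (𝓡 n) x).map_target hz
  have hX := fun ξ : Vec n ↦ smoothFieldOn_pushM x (M := M) (contDiff_const (c := ξ))
  have h := (contDiffAt_comp_extChartAt_symm hz (hsm _ _ _ (isOpen_extChartAt_source x) (hX ξ)
    (hX ζ))).differentiableAt (by simp)
  have hp : ∀ ξ : Vec n, pushM x (fun _ ↦ ξ) ((extChartAt (𝓡 n) x).symm z) =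
    frameAt n x ((extChartAt (𝓡 n) x).symm z) ξ := fun ξ ↦ pushM_apply hs _
  refine ⟨_, h.hasFDerivAt.congr_of_eventuallyEq ?_, fun v ↦ ?_⟩
  · filter_upwards [(isOpen_extChartAt_target x).mem_nhds hz] with z' hz'
    have hs' := (extChartAt (𝓡 n) x).map_target hz'
    rw [pushM_apply hs', pushM_apply hs']
    rfl
  · have h₁ := mvfderiv_eq_of_hasFDerivAt hz
      (f := fun y ↦ β y (pushM x (fun _ ↦ ξ) y) (pushM x (fun _ ↦ ζ) y)) h.hasFDerivAt
      (frameAt n x ((extChartAt (𝓡 n) x).symm z) v)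
    rw [coframeAt_frameAt hs] at h₁
    rw [← h₁, hΓ _ _ _ (isOpen_extChartAt_source x) (hX ξ) (hX ζ) _ hs, Γ.nabla_pushM_const hz,
      Γ.nabla_pushM_const hz, hp, hp]
    rfl

-- The common core of the metric and symplectic cases. If aC = A(v)a + b along a curve of frames,
-- the terms in A from the derivative of β and those hidden in b combine, so that β(aξ, aζ) has
-- derivative β(aCξ, aζ) + β(aξ, aCζ).
include hsm in
theorem LinearConnection.isFlatAffine_iff_etaIsHom_bilin (Γ : LinearConnection n M)
    (hΓ : ∀ (U : Set M) (Y Z : ∀ x : M, Tan (n := n) x), IsOpen U → SmoothFieldOn U Y →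
      SmoothFieldOn U Z → ∀ x ∈ U, ∀ v : Tan (n := n) x,
        mvfderiv (𝓡 n) (fun y ↦ β y (Y y) (Z y)) x v =
          β x (Γ.nabla Y x v) (Z x) + β x (Y x) (Γ.nabla Z x v))
    (w : Vec n → Vec n → ℝ) {𝔤 : LieSubalgebra ℝ (Gl n)}
    (h𝔤 : ∀ C : Gl n, (∀ ξ ζ, w (C ξ) ζ + w ξ (C ζ) = 0) → C ∈ 𝔤)
    (hsurj : ∀ y : M, ∃ a : Vec n ≃L[ℝ] Tan (n := n) y, ∀ ξ ζ, β y (a ξ) (a ζ) = w ξ ζ) :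
    Γ.IsFlatAffine ↔ Γ.EtaIsHom
      {u | u ∈ LM n M ∧ ∀ ξ ζ : Vec n, β u.proj (fr u ξ) (fr u ζ) = w ξ ζ} 𝔤 := by
  have h := Γ.isFlatAffine_iff_etaIsHom_of_hasDerivAt (𝔤 := 𝔤)
    (fun (i : Vec n × Vec n) u ↦ β u.proj (fr u i.1) (fr u i.2)) (fun i ↦ w i.1 i.2)
    (fun i u C ↦ β u.proj (fr u (C i.1)) (fr u i.2) + β u.proj (fr u i.1) (fr u (C i.2)))
    ?_ ?_ ?_ ?_
  · simpa only [Prod.forall] using h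
  · intro i u
    simp
  · rintro ⟨ξ, ζ⟩ x c c' t C hc hp - hC
    have h₁ : HasDerivAt (fun s ↦ (c s).2) c'.2 t := hc.snd
    have h₂ : ∀ ξ : Vec n, HasDerivAt (fun s ↦ (c s).2 ξ) (c'.2 ξ) t := fun ξ ↦ by
      simpa using h₁.clm_apply (hasDerivAt_const t ξ)
    have hC' : ∀ ξ : Vec n, (c t).2 (C ξ) = Γ.coeff x (c t).1 c'.1 ((c t).2 ξ) + c'.2 ξ :=
      fun ξ ↦ congrArg (fun T : Gl n ↦ T ξ) hC
    have key := hasDerivAt_bilin (β := fun s ↦ bilinCoord β x (c s).1)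
      (β' := (bilinCoord β x (c t).1).comp (Γ.coeff x (c t).1 c'.1) LinearMap.id +
        (bilinCoord β x (c t).1).comp LinearMap.id (Γ.coeff x (c t).1 c'.1))
      (t := t) (fun v w ↦ ?_) (h₂ ξ) (h₂ ζ)
    · refine key.congr_deriv ?_
      change _ = bilinCoord β x (c t).1 ((c t).2 (C ξ)) ((c t).2 ζ) +
        bilinCoord β x (c t).1 ((c t).2 ξ) ((c t).2 (C ζ))
      rw [hC', hC', LinearMap.map_add₂, map_add]
      change bilinCoord β x (c t).1 (Γ.coeff x (c t).1 c'.1 ((c t).2 ξ)) ((c t).2 ζ) +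
        bilinCoord β x (c t).1 ((c t).2 ξ) (Γ.coeff x (c t).1 c'.1 ((c t).2 ζ)) + _ + _ = _
      ring
    · obtain ⟨L, hL, e⟩ := Γ.hasFDerivAt_bilinCoord hsm hΓ hp v w
      exact (hL.comp_hasDerivAt t hc.fst).congr_deriv (e _)
  -- On Q the frame transports β to `w`, which turns the vanishing derivative into infinitesimal
  -- invariance of `w` under C.
  · rintro u ⟨a, ha⟩ hw C hC
    refine h𝔤 C fun ξ ζ ↦ ?_
    rw [← hC (ξ, ζ), ← hw (C ξ, ζ), ← hw (ξ, C ζ)]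
  · intro y v _
    obtain ⟨a, ha⟩ := hsurj y
    exact ⟨⟨y, (a : Vec n →L[ℝ] Tan (n := n) y)⟩, ⟨a, rfl⟩, fun i ↦ ha _ _, rfl⟩

end Bilin

end

section

attribute [local instance] LieRing.ofAssociativeRing

variable {n : ℕ} {M : Type*} [TopologicalSpace M] [ChartedSpace (Vec n) M] [IsManifold (𝓡 n) ∞ M]

/-! ### Bilinear forms on `ℝⁿ` given by a matrix -/

section Matrix

variable {ι : Type*} [Fintype ι] [DecidableEq ι]

lemma glMatrix_apply (C : Gl n) (i j : Fin n) :
    glMatrix n C i j = C (EuclideanSpace.single j 1) i := by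
  change LinearMap.toMatrix _ _ _ i j = _
  rw [LinearMap.toMatrix_apply]
  simp

/-- Tested on pairs of basis vectors, the hypothesis is CᵀJ + JC = 0 entry by entry. Both `so'` and
`sp` are the skew-adjoint matrices of some J. -/
lemma reindex_glMatrix_mem (e : ι ≃ Fin n) (J : Matrix ι ι ℝ) (C : Gl n)
    (h : ∀ ξ ζ : Vec n, ∑ i, ∑ j, C ξ (e i) * ζ (e j) * J i j +
      ∑ i, ∑ j, ξ (e i) * C ζ (e j) * J i j = 0) :
    Matrix.reindexLieEquiv (R := ℝ) e.symm (glMatrix n C) ∈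
      skewAdjointMatricesLieSubalgebra J := by
  rw [mem_skewAdjointMatricesLieSubalgebra, mem_skewAdjointMatricesSubmodule]
  change _ * J = J * -_
  ext i j
  have := h (EuclideanSpace.single (e i) 1) (EuclideanSpace.single (e j) 1)
  rw [mul_neg, Matrix.neg_apply, Matrix.mul_apply, Matrix.mul_apply, eq_neg_iff_add_eq_zero,
    ← this]
  simp only [Matrix.transpose_apply, Matrix.reindexLieEquiv_apply, Matrix.reindex_apply,
    Matrix.submatrix_apply, Equiv.symm_symm, glMatrix_apply]
  congr 1
  · refine Finset.sum_congr rfl fun k _ ↦ ?_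
    rw [Finset.sum_eq_single j]
    · simp
    · intro l _ hl
      simp [hl]
    · simp
  · symm
    rw [Finset.sum_eq_single i]
    · refine Finset.sum_congr rfl fun k _ ↦ ?_
      simp [mul_comm]
    · intro l _ hl
      simp [hl]
    · simp

lemma bilin_sum_smul {V : Type*} [AddCommGroup V] [Module ℝ V] (β : LinearMap.BilinForm ℝ V)
    {v : ι → V} {K : Matrix ι ι ℝ} (hv : ∀ i j, β (v i) (v j) = K i j) (x y : ι → ℝ) :
    β (∑ i, x i • v i) (∑ i, y i • v i) = ∑ i, ∑ j, x i * y j * K i j := by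
  simp only [map_sum, map_smul, LinearMap.sum_apply, LinearMap.smul_apply, smul_eq_mul,
    Finset.mul_sum, hv]
  rw [Finset.sum_comm]
  exact Finset.sum_congr rfl fun i _ ↦ Finset.sum_congr rfl fun j _ ↦ by ring

lemma exists_equiv_of_basis {y : M} (e : ι ≃ Fin n) (K : Matrix ι ι ℝ)
    (β : LinearMap.BilinForm ℝ (Tan (n := n) y)) (b : Module.Basis ι ℝ (Tan (n := n) y))
    (hb : ∀ i j, β (b i) (b j) = K i j) :
    ∃ a : Vec n ≃L[ℝ] Tan (n := n) y, ∀ ξ ζ : Vec n,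
      β (a ξ) (a ζ) = ∑ i, ∑ j, ξ (e i) * ζ (e j) * K i j := by
  let a : Vec n ≃ₗ[ℝ] Vec n :=
    (EuclideanSpace.basisFun (Fin n) ℝ).toBasis.equiv (b : Module.Basis ι ℝ (Vec n)) e.symm
  have ha : ∀ ξ, a ξ = ∑ i, ξ (e i) • (b i : Vec n) := fun ξ ↦ by
    conv_lhs => rw [← (EuclideanSpace.basisFun (Fin n) ℝ).sum_repr ξ]
    rw [map_sum, ← e.sum_comp]
    refine Finset.sum_congr rfl fun i _ ↦ ?_
    rw [map_smul, EuclideanSpace.basisFun_repr]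
    congr 1
    have := (EuclideanSpace.basisFun (Fin n) ℝ).toBasis.equiv_apply (e i)
      (b : Module.Basis ι ℝ (Vec n)) e.symm
    rw [e.symm_apply_apply, OrthonormalBasis.coe_toBasis] at this
    exact this
  refine ⟨a.toContinuousLinearEquiv, fun ξ ζ ↦ ?_⟩
  change β (a ξ) (a ζ) = _
  rw [ha, ha]
  exact bilin_sum_smul β hb _ _

/-- Pairing a vanishing combination with each `v j` gives cK = 0, and K is invertible. -/
lemma linearIndependent_of_bilin {V : Type*} [AddCommGroup V] [Module ℝ V]
    (β : LinearMap.BilinForm ℝ V) {v : ι → V} {K : Matrix ι ι ℝ}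
    (hv : ∀ i j, β (v i) (v j) = K i j) (hK : K.det ≠ 0) : LinearIndependent ℝ v := by
  rw [Fintype.linearIndependent_iff]
  intro c hc
  refine congrFun (Matrix.eq_zero_of_vecMul_eq_zero hK (funext fun j ↦ ?_))
  have := congrArg (fun w ↦ β w (v j)) hc
  simpa [Matrix.vecMul, dotProduct, hv] using this

end Matrix

lemma stdMetric_eq {p q : ℕ} (e : Fin p ⊕ Fin q ≃ Fin n) (ξ ζ : Vec n) :
    stdMetric e ξ ζ = ∑ i, ∑ j, ξ (e i) * ζ (e j) *
      LieAlgebra.Orthogonal.indefiniteDiagonal (Fin p) (Fin q) ℝ i j := by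
  simp [stdMetric, LieAlgebra.Orthogonal.indefiniteDiagonal, Matrix.diagonal_apply, sub_eq_add_neg]

/-- `Matrix.J` has −1 in its upper right block, hence the sign. The sign does not affect the
skew-adjointness condition. -/
lemma stdSymplectic_eq {m : ℕ} (e : Fin m ⊕ Fin m ≃ Fin n) (ξ ζ : Vec n) :
    stdSymplectic e ξ ζ = ∑ i, ∑ j, ξ (e i) * ζ (e j) * (-Matrix.J (Fin m) ℝ) i j := by
  simp [stdSymplectic, Matrix.J, Matrix.one_apply, sub_eq_add_neg, Finset.sum_add_distrib]

/-! ### Symplectic bases -/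

section Symplectic

variable {V : Type*} [AddCommGroup V] [Module ℝ V]

/-- `p₁, q₁, …, pₖ, qₖ` satisfy the relations of a symplectic basis. -/
structure IsSymplecticFamily (σ : LinearMap.BilinForm ℝ V) {k : ℕ} (p q : Fin k → V) : Prop where
  pp : ∀ i j, σ (p i) (p j) = 0
  qq : ∀ i j, σ (q i) (q j) = 0
  pq : ∀ i j, σ (p i) (q j) = if i = j then 1 else 0

/-- The projection step of the symplectic Gram–Schmidt process, with s = ∑ (σ(pᵢ, v)qᵢ − σ(qᵢ,
v)pᵢ). -/
lemma IsSymplecticFamily.exists_sub_orthogonal {σ : LinearMap.BilinForm ℝ V} (hσ : σ.IsAlt) {k : ℕ}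
    {p q : Fin k → V} (h : IsSymplecticFamily σ p q) (v : V) :
    ∃ s ∈ Submodule.span ℝ (range (Sum.elim p q)), ∀ i, σ (p i) (v - s) = 0 ∧
      σ (q i) (v - s) = 0 := by
  have hqp : ∀ i j, σ (q i) (p j) = if i = j then -1 else 0 := fun i j ↦ by
    rw [← hσ.neg_eq, h.pq]
    by_cases hij : i = j <;> simp [hij, eq_comm]
  refine ⟨∑ i, (σ (p i) v • q i - σ (q i) v • p i), Submodule.sum_mem _ fun i _ ↦
    Submodule.sub_mem _ (Submodule.smul_mem _ _ (Submodule.subset_span ⟨.inr i, rfl⟩))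
      (Submodule.smul_mem _ _ (Submodule.subset_span ⟨.inl i, rfl⟩)), fun i ↦ ⟨?_, ?_⟩⟩
  · simp [h.pp, h.pq]
  · simp [h.qq, hqp]

/-- For k < m the 2k vectors do not span. A vector outside the span is made orthogonal to it and
remains nonzero; nondegeneracy supplies a partner, which is normalized and made orthogonal in turn.
-/
lemma exists_isSymplecticFamily [FiniteDimensional ℝ V] {σ : LinearMap.BilinForm ℝ V}
    (hσ : σ.IsAlt) (hnd : ∀ v, (∀ w, σ v w = 0) → v = 0) {m : ℕ}
    (hm : 2 * m ≤ Module.finrank ℝ V) (k : ℕ) (hk : k ≤ m) :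
    ∃ p q : Fin k → V, IsSymplecticFamily σ p q := by
  induction k with
  | zero => exact ⟨0, 0, ⟨fun i ↦ i.elim0, fun i ↦ i.elim0, fun i ↦ i.elim0⟩⟩
  | succ k ih =>
    obtain ⟨p, q, h⟩ := ih (by omega)
    have hlt : Submodule.span ℝ (range (Sum.elim p q)) < ⊤ := by
      refine Submodule.lt_top_of_finrank_lt_finrank ?_
      have := finrank_range_le_card (R := ℝ) (Sum.elim p q)
      rw [Set.finrank, Fintype.card_sum, Fintype.card_fin] at this
      omega
    obtain ⟨x, -, hx⟩ := SetLike.exists_of_lt hlt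
    obtain ⟨s, hs, hxs⟩ := h.exists_sub_orthogonal hσ x
    have hx₀ : x - s ≠ 0 := fun h₀ ↦ hx (by rwa [sub_eq_zero.1 h₀])
    obtain ⟨y, hy⟩ : ∃ y, σ (x - s) y ≠ 0 := by
      by_contra! hcon
      exact hx₀ (hnd _ hcon)
    obtain ⟨t, ht, hyt⟩ := h.exists_sub_orthogonal hσ ((σ (x - s) y)⁻¹ • y)
    have hxp : ∀ i, σ (x - s) (p i) = 0 := fun i ↦ by rw [← hσ.neg_eq, (hxs i).1, neg_zero]
    have hxq : ∀ i, σ (x - s) (q i) = 0 := fun i ↦ by rw [← hσ.neg_eq, (hxs i).2, neg_zero]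
    -- Since `x - s` is orthogonal to the span, correcting the partner by `t` does not change its
    -- pairing with `x - s`.
    have hxt : σ (x - s) t = 0 := by
      have : Submodule.span ℝ (range (Sum.elim p q)) ≤ LinearMap.ker (σ (x - s)) := by
        rw [Submodule.span_le]
        rintro _ ⟨i | i, rfl⟩
        · exact hxp i
        · exact hxq i
      exact this ht
    have hxy : σ (x - s) ((σ (x - s) y)⁻¹ • y - t) = 1 := by
      rw [map_sub, hxt, map_smul, sub_zero, smul_eq_mul, inv_mul_cancel₀ hy]
    generalize x - s = x' at *
    generalize (σ x' y)⁻¹ • y - t = y' at *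
    refine ⟨Fin.cons x' p, Fin.cons y' q, ⟨fun i j ↦ ?_, fun i j ↦ ?_, fun i j ↦ ?_⟩⟩
    · refine Fin.cases ?_ (fun i ↦ ?_) i <;> refine Fin.cases ?_ (fun j ↦ ?_) j
      · simpa using hσ x'
      · simpa using hxp j
      · simpa using (hxs i).1
      · simpa using h.pp i j
    · refine Fin.cases ?_ (fun i ↦ ?_) i <;> refine Fin.cases ?_ (fun j ↦ ?_) j
      · simpa using hσ y'
      · simpa [(hyt j).2] using (hσ.neg_eq (q j) y').symm
      · simpa using (hyt i).2
      · simpa using h.qq i j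
    · refine Fin.cases ?_ (fun i ↦ ?_) i <;> refine Fin.cases ?_ (fun j ↦ ?_) j
      · simpa using hxy
      · simpa [(Fin.succ_ne_zero j).symm] using hxq j
      · simpa using (hyt i).1
      · simpa using h.pq i j

lemma exists_symplecticBasis [FiniteDimensional ℝ V] {σ : LinearMap.BilinForm ℝ V}
    (hσ : σ.IsAlt) (hnd : ∀ v, (∀ w, σ v w = 0) → v = 0) {m : ℕ}
    (hm : Module.finrank ℝ V = m + m) :
    ∃ b : Module.Basis (Fin m ⊕ Fin m) ℝ V, ∀ i j, σ (b i) (b j) = (-Matrix.J (Fin m) ℝ) i j := by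
  obtain ⟨p, q, h⟩ := exists_isSymplecticFamily hσ hnd (m := m) (by omega) m le_rfl
  have hpq : ∀ i j, σ (Sum.elim p q i) (Sum.elim p q j) = (-Matrix.J (Fin m) ℝ) i j := by
    rintro (i | i) (j | j)
    · simp [h.pp, Matrix.J]
    · simp [h.pq, Matrix.J, Matrix.one_apply]
    · simp [← hσ.neg_eq (p j), h.pq, Matrix.J, Matrix.one_apply, eq_comm]
    · simp [h.qq, Matrix.J]
  have hli := linearIndependent_of_bilin σ hpq (by
    rw [Matrix.det_neg]
    exact mul_ne_zero (by simp) (Matrix.isUnit_det_J (Fin m) ℝ).ne_zero)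
  refine ⟨basisOfLinearIndependentOfCardEqFinrank' _ hli (by simp [hm]), fun i j ↦ ?_⟩
  rw [coe_basisOfLinearIndependentOfCardEqFinrank', hpq]

end Symplectic

theorem isFlatAffine_iff_etaIsHom_orthogonal (Γ : LinearConnection n M) {p q : ℕ}
    (e : Fin p ⊕ Fin q ≃ Fin n) (g : PseudoMetric n M) (hg : g.HasSignature p q)
    (hΓ : Γ.PreservesMetric g) : Γ.IsFlatAffine ↔ Γ.EtaIsHom (g.frames e) (oAlg e) := by
  refine Γ.isFlatAffine_iff_etaIsHom_bilin (β := g.val) g.smooth hΓ (stdMetric e)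
    (fun C hC ↦ ?_) fun y ↦ ?_
  · refine reindex_glMatrix_mem e (LieAlgebra.Orthogonal.indefiniteDiagonal (Fin p) (Fin q) ℝ) C
      fun ξ ζ ↦ ?_
    rw [← stdMetric_eq, ← stdMetric_eq, hC]
  · obtain ⟨b, hb⟩ := hg y
    obtain ⟨a, ha⟩ := exists_equiv_of_basis e _ _ b hb
    exact ⟨a, fun ξ ζ ↦ by rw [ha, stdMetric_eq]⟩

theorem isFlatAffine_iff_etaIsHom_symplectic (Γ : LinearConnection n M) {m : ℕ}
    (e : Fin m ⊕ Fin m ≃ Fin n) (σ : SymplecticForm n M)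
    (hΓ : Γ.PreservesSymplectic σ) : Γ.IsFlatAffine ↔ Γ.EtaIsHom (σ.frames e) (spAlg e) := by
  refine Γ.isFlatAffine_iff_etaIsHom_bilin (β := σ.val) σ.smooth hΓ (stdSymplectic e)
    (fun C hC ↦ ?_) fun y ↦ ?_
  · refine reindex_glMatrix_mem e (Matrix.J (Fin m) ℝ) C fun ξ ζ ↦ ?_
    have := hC ξ ζ
    rw [stdSymplectic_eq, stdSymplectic_eq] at this
    simp only [Matrix.neg_apply, mul_neg, Finset.sum_neg_distrib] at this
    linarith
  · have hdim : Module.finrank ℝ (Tan (n := n) y) = m + m := by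
      have h : Module.finrank ℝ (Vec n) = n := by simp
      have := Fintype.card_congr e
      simp only [Fintype.card_sum, Fintype.card_fin] at this
      rw [this]
      exact h
    have : FiniteDimensional ℝ (Tan (n := n) y) := inferInstanceAs (FiniteDimensional ℝ (Vec n))
    obtain ⟨b, hb⟩ := exists_symplecticBasis (σ := σ.val y) (σ.alt y) (σ.nondegenerate y) hdim
    obtain ⟨a, ha⟩ := exists_equiv_of_basis e _ _ b hb
    exact ⟨a, fun ξ ζ ↦ by rw [ha, stdSymplectic_eq]⟩

end

section

attribute [local instance] LieRing.ofAssociativeRing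

variable {n : ℕ} {M : Type*} [TopologicalSpace M] [ChartedSpace (Vec n) M] [IsManifold (𝓡 n) ∞ M]

/-! ### Parallel volume forms -/

/-- Expand f(bᵢ) in the basis: every term but the i-th repeats a basis vector and vanishes, leaving
the diagonal entry of f. -/
lemma sum_update_eq_trace_mul {ι V : Type*} [Fintype ι] [DecidableEq ι] [AddCommGroup V]
    [Module ℝ V] (Ω : V [⋀^ι]→ₗ[ℝ] ℝ) (b : Module.Basis ι ℝ V) (f : V →ₗ[ℝ] V) :
    ∑ i, Ω (Function.update b i (f (b i))) = LinearMap.trace ℝ V f * Ω b := by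
  have h : ∀ i j, Ω (Function.update b i (b j)) = if i = j then Ω b else 0 := fun i j ↦ by
    split_ifs with hij
    · rw [hij, Function.update_eq_self]
    · exact Ω.map_update_self _ hij
  rw [LinearMap.trace_eq_matrix_trace ℝ b, Matrix.trace, Finset.sum_mul]
  refine Finset.sum_congr rfl fun i _ ↦ ?_
  conv_lhs => rw [← b.sum_repr (f (b i))]
  rw [← AlternatingMap.coe_multilinearMap, MultilinearMap.map_update_sum]
  simp only [AlternatingMap.coe_multilinearMap, AlternatingMap.map_update_smul, h, Matrix.diag,
    LinearMap.toMatrix_apply]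
  simp

lemma hasDerivAt_det {c : ℝ → Fin n → Vec n} {c' : Fin n → Vec n} {t : ℝ}
    (hc : HasDerivAt c c' t) :
    HasDerivAt (fun s ↦ (EuclideanSpace.basisFun (Fin n) ℝ).toBasis.det (c s))
      (∑ i, (EuclideanSpace.basisFun (Fin n) ℝ).toBasis.det (Function.update (c t) i (c' i))) t := by
  have hcont : Continuous fun v : Fin n → Vec n ↦
      (EuclideanSpace.basisFun (Fin n) ℝ).toBasis.det v := by
    simp only [Module.Basis.det_apply]
    refine Continuous.matrix_det ?_
    refine continuous_matrix fun i j ↦ ?_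
    exact (EuclideanSpace.proj (𝕜 := ℝ) i : Vec n →L[ℝ] ℝ).continuous.comp (continuous_apply j)
  let f : ContinuousMultilinearMap ℝ (fun _ : Fin n ↦ Vec n) ℝ :=
    ⟨(EuclideanSpace.basisFun (Fin n) ℝ).toBasis.det.toMultilinearMap, hcont⟩
  refine ((f.hasFDerivAt (c t)).comp_hasDerivAt t hc).congr_deriv ?_
  rw [ContinuousMultilinearMap.linearDeriv_apply]
  rfl

/-- The components of a field of alternating forms in the chart around `x`. -/
def volCoord (μ : VolumeForm n M) (x : M) (z : Vec n) : Vec n [⋀^Fin n]→ₗ[ℝ] ℝ :=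
  (μ.val ((extChartAt (𝓡 n) x).symm z)).compLinearMap
    (frameAt n x ((extChartAt (𝓡 n) x).symm z) : Vec n →ₗ[ℝ] _)

lemma LinearConnection.hasFDerivAt_volCoord (Γ : LinearConnection n M) {μ : VolumeForm n M}
    (hΓ : Γ.PreservesVolume μ) {x : M} {z : Vec n} (hz : z ∈ (extChartAt (𝓡 n) x).target)
    (b : Module.Basis (Fin n) ℝ (Vec n)) :
    ∃ L : Vec n →L[ℝ] ℝ, HasFDerivAt (fun z ↦ volCoord μ x z b) L z ∧ ∀ v, L v =
      LinearMap.trace ℝ (Vec n) (Γ.coeff x z v) * volCoord μ x z b := by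
  have hs := (extChartAt (𝓡 n) x).map_target hz
  have hX := fun i ↦ smoothFieldOn_pushM x (M := M) (contDiff_const (c := b i))
  have h := (contDiffAt_comp_extChartAt_symm hz (μ.smooth _ _ (isOpen_extChartAt_source x)
    hX)).differentiableAt (by simp)
  have hp : ∀ ξ : Vec n, pushM x (fun _ ↦ ξ) ((extChartAt (𝓡 n) x).symm z) =
    frameAt n x ((extChartAt (𝓡 n) x).symm z) ξ := fun ξ ↦ pushM_apply hs _
  refine ⟨_, h.hasFDerivAt.congr_of_eventuallyEq ?_, fun v ↦ ?_⟩
  · filter_upwards [(isOpen_extChartAt_target x).mem_nhds hz] with z' hz'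
    have hs' := (extChartAt (𝓡 n) x).map_target hz'
    simp only [pushM_apply hs']
    rfl
  · have h₁ := mvfderiv_eq_of_hasFDerivAt hz
      (f := fun y ↦ μ.val y (fun i ↦ pushM x (fun _ ↦ b i) y)) h.hasFDerivAt
      (frameAt n x ((extChartAt (𝓡 n) x).symm z) v)
    rw [coframeAt_frameAt hs] at h₁
    rw [← h₁, hΓ _ _ (isOpen_extChartAt_source x) hX _ hs, ← sum_update_eq_trace_mul]
    refine Finset.sum_congr rfl fun i _ ↦ ?_
    rw [Γ.nabla_pushM_const hz]
    refine congrArg (μ.val ((extChartAt (𝓡 n) x).symm z)) (funext fun j ↦ ?_)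
    by_cases hj : j = i
    · subst hj
      simp only [Function.update_self]
      rfl
    · simp only [Function.update_of_ne hj]
      exact hp _

/-- Parallelism contributes tr A(v) times the volume, and moving the frame contributes ∑ μ(…, b eᵢ,
…) with b = aC − A(v)a. The traces of A(v) cancel and tr C remains. -/
lemma LinearConnection.hasDerivAt_volCoord (Γ : LinearConnection n M) {μ : VolumeForm n M}
    (hΓ : Γ.PreservesVolume μ) {x : M} {c : ℝ → Vec n × Gl n} {c' : Vec n × Gl n} {t : ℝ}
    {C : Gl n} (hc : HasDerivAt c c' t) (hp : (c t).1 ∈ (extChartAt (𝓡 n) x).target)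
    (ha : (c t).2.IsInvertible)
    (hC : (c t).2 * C = Γ.coeff x (c t).1 c'.1 * (c t).2 + c'.2) :
    HasDerivAt (fun s ↦ volCoord μ x (c s).1 (fun i ↦ (c s).2 (EuclideanSpace.single i 1)))
      (LinearMap.trace ℝ (Vec n) C *
        volCoord μ x (c t).1 (fun i ↦ (c t).2 (EuclideanSpace.single i 1))) t := by
  obtain ⟨g, hg⟩ := ha
  obtain ⟨b, hb⟩ : ∃ b, b = (EuclideanSpace.basisFun (Fin n) ℝ).toBasis := ⟨_, rfl⟩
  have hbi : ∀ i, b i = EuclideanSpace.single i 1 := fun i ↦ by simp [hb]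
  simp only [← hbi]
  have h₁ : HasDerivAt (fun s ↦ (c s).2) c'.2 t := hc.snd
  have h₂ : HasDerivAt (fun s i ↦ (c s).2 (b i)) (fun i ↦ c'.2 (b i)) t :=
    hasDerivAt_pi.2 fun i ↦ by simpa using h₁.clm_apply (hasDerivAt_const t (b i))
  obtain ⟨L, hL, e⟩ := Γ.hasFDerivAt_volCoord hΓ hp b
  have h₃ : HasDerivAt (fun s ↦ volCoord μ x (c s).1 b) (L c'.1) t := by
    have h := hL.comp_hasDerivAt t hc.fst
    exact h
  have hdet : ∀ z v, volCoord μ x z v = volCoord μ x z b * b.det v := fun z v ↦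
    congrArg (fun Ω : Vec n [⋀^Fin n]→ₗ[ℝ] ℝ ↦ Ω v) ((volCoord μ x z).eq_smul_basis_det b)
  have key := h₃.fun_mul (hasDerivAt_det h₂)
  rw [← hb] at key
  have e₁ : (fun s ↦ volCoord μ x (c s).1 (fun i ↦ (c s).2 (b i))) =
      fun s ↦ volCoord μ x (c s).1 b * b.det (fun i ↦ (c s).2 (b i)) := funext fun s ↦ hdet _ _
  rw [e₁]
  refine key.congr_deriv ?_
  rw [e, mul_assoc, ← hdet, Finset.mul_sum]
  simp only [← hdet]
  have hC' : ∀ i, c'.2 (b i) = (c t).2 (C (b i)) - Γ.coeff x (c t).1 c'.1 ((c t).2 (b i)) :=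
    fun i ↦ eq_sub_of_add_eq' (congrArg (fun T : Gl n ↦ T (b i)) hC).symm
  -- The invertible frame sends the standard basis to a basis. The trace formula is used in that
  -- basis for A(v), and in the standard one, with the volume pulled back by the frame, for C.
  have s₁ := sum_update_eq_trace_mul (volCoord μ x (c t).1)
    (b.map g.toLinearEquiv) (Γ.coeff x (c t).1 c'.1 : Vec n →ₗ[ℝ] Vec n)
  have s₂ := sum_update_eq_trace_mul
    ((volCoord μ x (c t).1).compLinearMap ((c t).2 : Vec n →ₗ[ℝ] Vec n)) b (C : Vec n →ₗ[ℝ] Vec n)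
  have hbg : (b.map g.toLinearEquiv : Fin n → Vec n) = fun i ↦ (c t).2 (b i) := by
    ext1 i
    rw [← hg]
    simp
  rw [hbg] at s₁
  simp only [ContinuousLinearMap.coe_coe] at s₁
  simp only [hC', AlternatingMap.map_update_sub, Finset.sum_sub_distrib]
  rw [s₁, add_sub_cancel]
  refine Eq.trans (Finset.sum_congr rfl fun i _ ↦ ?_) s₂
  refine congrArg (volCoord μ x (c t).1) (funext fun j ↦ ?_)
  by_cases hj : j = i
  · subst hj
    simp
  · simp [hj]

lemma mem_slAlg {C : Gl n} (h : LinearMap.trace ℝ (Vec n) (C : Vec n →ₗ[ℝ] Vec n) = 0) :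
    C ∈ slAlg n := by
  rw [LinearMap.trace_eq_matrix_trace ℝ (EuclideanSpace.basisFun (Fin n) ℝ).toBasis] at h
  exact h

lemma exists_equiv_volume {y : M} {v : Vec n} (hv : v ≠ 0)
    (Ω : Tan (n := n) y [⋀^Fin n]→ₗ[ℝ] ℝ) (hΩ : Ω ≠ 0) :
    ∃ a : Vec n ≃L[ℝ] Tan (n := n) y, Ω (fun i ↦ a (EuclideanSpace.single i 1)) = 1 := by
  -- Only the existence of an index matters: the volume is normalized by rescaling the single basis
  -- vector at `i₀`.
  obtain ⟨i₀, -⟩ : ∃ i, v i ≠ 0 := by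
    by_contra! h
    exact hv (by ext i; exact h i)
  let Ω' : Vec n [⋀^Fin n]→ₗ[ℝ] ℝ := Ω
  let b := (EuclideanSpace.basisFun (Fin n) ℝ).toBasis
  have h₀ : Ω' b ≠ 0 := fun h ↦ hΩ ((AlternatingMap.map_basis_eq_zero_iff b Ω').1 h)
  let w : Fin n → ℝˣ := Function.update 1 i₀ (Units.mk0 _ h₀)⁻¹
  let b' := b.unitsSMul w
  let a : Vec n ≃ₗ[ℝ] Vec n := b.equiv b' (Equiv.refl _)
  refine ⟨a.toContinuousLinearEquiv, ?_⟩
  have ha : (fun i ↦ a (EuclideanSpace.single i 1)) = fun i ↦ (w i : ℝ) • b i := by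
    ext1 i
    have := b.equiv_apply i b' (Equiv.refl _)
    have hbi : b i = EuclideanSpace.single i 1 := by simp [b]
    rw [← hbi, this]
    exact b.unitsSMul_apply i
  change Ω' (fun i ↦ a (EuclideanSpace.single i 1)) = 1
  rw [ha, Ω'.map_smul_univ]
  have hprod : ∏ i, (w i : ℝ) = (Ω' b)⁻¹ := by
    rw [Finset.prod_eq_single i₀]
    · simp [w]
    · intro j _ hj
      simp [w, hj]
    · simp
  rw [hprod]
  exact inv_mul_cancel₀ h₀

theorem isFlatAffine_iff_etaIsHom_volume (Γ : LinearConnection n M) (μ : VolumeForm n M)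
    (hΓ : Γ.PreservesVolume μ) : Γ.IsFlatAffine ↔ Γ.EtaIsHom μ.frames (slAlg n) := by
  have h := Γ.isFlatAffine_iff_etaIsHom_of_hasDerivAt (𝔤 := slAlg n) (ι := Unit)
    (fun _ u ↦ μ.val u.proj (fun i ↦ fr u (EuclideanSpace.single i 1))) (fun _ ↦ 1)
    (fun _ u C ↦ LinearMap.trace ℝ (Vec n) (C : Vec n →ₗ[ℝ] Vec n) *
      μ.val u.proj (fun i ↦ fr u (EuclideanSpace.single i 1)))
    ?_ ?_ ?_ ?_
  · simp only [forall_const] at h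
    exact h
  · intro _ u
    simp
  · intro _ x c c' t C hc hp hLM hC
    exact Γ.hasDerivAt_volCoord hΓ hc hp ((ofCoord_mem_LM_iff hp).1 hLM) hC
  -- The derivative is tr C times the volume of the frame; on Q the volume is 1, so the trace
  -- vanishes.
  · intro u _ hu C hC
    have := hC ()
    rw [hu (), mul_one] at this
    exact mem_slAlg this
  · intro y v hv
    obtain ⟨a, ha⟩ := exists_equiv_volume hv (μ.val y) (μ.ne_zero y)
    exact ⟨⟨y, (a : Vec n →L[ℝ] Tan (n := n) y)⟩, ⟨a, rfl⟩, fun _ ↦ ha, rfl⟩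

end

end FlatAffine

end

theorem mainTheorem10 {n : ℕ} {M : Type*} [TopologicalSpace M] [ChartedSpace (FlatAffine.Vec n) M]
    [IsManifold (𝓡 n) ∞ M] (Γ : FlatAffine.LinearConnection n M) :
    (∀ (p q : ℕ) (e : Fin p ⊕ Fin q ≃ Fin n) (g : FlatAffine.PseudoMetric n M),
      g.HasSignature p q → Γ.PreservesMetric g →
      (Γ.IsFlatAffine ↔ Γ.EtaIsHom (g.frames e) (FlatAffine.oAlg e))) ∧
    (∀ μ : FlatAffine.VolumeForm n M, Γ.PreservesVolume μ →
      (Γ.IsFlatAffine ↔ Γ.EtaIsHom μ.frames (FlatAffine.slAlg n))) ∧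
    (∀ (m : ℕ) (e : Fin m ⊕ Fin m ≃ Fin n) (σ : FlatAffine.SymplecticForm n M),
      Γ.PreservesSymplectic σ →
      (Γ.IsFlatAffine ↔ Γ.EtaIsHom (σ.frames e) (FlatAffine.spAlg e))) :=
  ⟨fun _ _ e g hg hΓ ↦ FlatAffine.isFlatAffine_iff_etaIsHom_orthogonal Γ e g hg hΓ,
    fun μ hΓ ↦ FlatAffine.isFlatAffine_iff_etaIsHom_volume Γ μ hΓ,
    fun _ e σ hΓ ↦ FlatAffine.isFlatAffine_iff_etaIsHom_symplectic Γ e σ hΓ⟩
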